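/- For a positive integer $n$, an increasing tree of size $n$ is a planar binary tree with $n$ nodes labeled $1,2,\dots,n$, in which each node has at most one left child and at most one right child and its label is smaller than the labels of its children. Its rightmost node is reached from the root by going to the right child as long as there is one. The tree is called complete if every node is either a leaf or has two children, except that, when $n$ is even, the rightmost node has one left child and no right child. Let $\mathfrak T_n$ be the set of complete increasing trees of size $n$; those of even size are called secant trees. The minimal chain of $t\in\mathfrak T_n$ starts at the root and goes from each interior node to its child with the smallest label (to its only child, if there is just one), until a leaf is reached; the label of that leaf is denoted by $\mathrm{eoc}(t)$. For $n\ge 2$, let $\mathrm{pom}(t)$ be the label of the parent of the leaf labeled $n$. Put $$f_{2n}(m,k):=\#\{t\in\mathfrak T_{2n}:\ \mathrm{eoc}(t)=m \text{ and } \mathrm{pom}(t)=k\},$$ $$\Delta_m f_{2n}(m,k):=f_{2n}(m+1,k)-f_{2n}(m,k),\qquad \Delta_k f_{2n}(m,k):=f_{2n}(m,k+1)-f_{2n}(m,k).$$ **Theorem 1.1.** The following two systems of finite difference equations hold: $$\Delta_m^2 f_{2n}(m,k)+4f_{2n-2}(m,k-2)=0\qquad(2\le m\le k-3<k\le 2n-1),\tag{R1}$$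 $$\Delta_k^2 f_{2n}(m,k)+4f_{2n-2}(m,k)=0\qquad(2\le m\le k-1<k\le 2n-3).\tag{R2}$$ -/

import Mathlib

/-!
Secant trees are modelled on Mathlib's `BinaryTree ℕ`: `nil` is the empty tree, and
`node a l r` is a node labelled `a` with left subtree `l` and right subtree `r`, so that a node
has a left (right) child iff its left (right) subtree is not `nil`.
-/

namespace SecantTree

open BinaryTree

/-- The labels of a tree, read by projecting its nodes onto a horizontal axis, from left to
right. -/
def inorder : BinaryTree ℕ → List ℕ
  | nil => []
  | node a l r => inorder l ++ a :: inorder r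

/-- The label of the root, if the tree is not empty. -/
def root? : BinaryTree ℕ → Option ℕ
  | nil => none
  | node a _ _ => some a

/-- The label of each node is smaller than the labels of its children. -/
def LabelsIncrease : BinaryTree ℕ → Prop
  | nil => True
  | node a l r =>
      (∀ b, root? l = some b → a < b) ∧ (∀ b, root? r = some b → a < b) ∧
        LabelsIncrease l ∧ LabelsIncrease r

/-- Increasing (planar, binary) trees with `n` nodes, labelled `1, 2, …, n`. (For `n ≥ 1` the root
is then labelled `1`.) -/
def IsIncreasing (n : ℕ) (t : BinaryTree ℕ) : Prop :=
  (inorder t).Perm (List.range' 1 n) ∧ LabelsIncrease t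

/-- Every node is a leaf or has two children. -/
def IsFull : BinaryTree ℕ → Prop
  | nil => True
  | node _ l r => (l = nil ↔ r = nil) ∧ IsFull l ∧ IsFull r

/-- Every node, except possibly the rightmost one, is a leaf or has two children. The rightmost
node is reached from the root by going to the right child as long as there is one; so a node of
this path that has a right child is not the rightmost node, and must have a left child too. -/
def IsFullExceptRightmost : BinaryTree ℕ → Prop
  | nil => True
  | node _ l r => (r ≠ nil → l ≠ nil) ∧ IsFull l ∧ IsFullExceptRightmost r

/-- The subtree hanging from the rightmost node. -/
def rightmost : BinaryTree ℕ → BinaryTree ℕ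
  | nil => nil
  | node a l nil => node a l nil
  | node _ _ (node b l' r') => rightmost (node b l' r')

/-- Complete increasing trees with `n` nodes: every node is a leaf or has two children, except that
the rightmost node has one left child and no right child when `n` is even. (The rightmost node never
has a right child.) For even `n ≥ 2` these are the secant trees. -/
def IsCompleteIncreasing (n : ℕ) (t : BinaryTree ℕ) : Prop :=
  IsIncreasing n t ∧ IsFullExceptRightmost t ∧ ((rightmost t).left ≠ nil ↔ Even n)

/-- The set `𝔗ₙ` of complete increasing trees of size `n`. -/
def completeTrees (n : ℕ) : Set (BinaryTree ℕ) :=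
  {t | IsCompleteIncreasing n t}

/-- The end of the minimal chain: starting from the root, go from each interior node to its child
with the smallest label, until a leaf is reached. (The value `0` on the empty tree is not used.) -/
def eoc : BinaryTree ℕ → ℕ
  | nil => 0
  | node a nil nil => a
  | node _ (node b l r) nil => eoc (node b l r)
  | node _ nil (node c l' r') => eoc (node c l' r')
  | node _ (node b l r) (node c l' r') =>
      if b < c then eoc (node b l r) else eoc (node c l' r')

/-- The label of the parent of the node labelled `x`, if there is one. -/
def parent? (x : ℕ) : BinaryTree ℕ → Option ℕ
  | nil => none
  | node a l r =>
      if root? l = some x ∨ root? r = some x then some a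
      else (parent? x l).or (parent? x r)

/-- The parent of the maximum leaf: in a tree of size `n` with labels `1, …, n`, the label of the
parent of the leaf labelled `n`. (The value `0` if there is no parent, i.e. `n ≤ 1`, is not
used.) -/
def pom (t : BinaryTree ℕ) : ℕ :=
  (parent? t.numNodes t).getD 0

/-- `f n m k` is the number of complete increasing trees of size `n` with `eoc = m` and
`pom = k`. -/
noncomputable def f (n m k : ℕ) : ℤ :=
  ({t ∈ completeTrees n | eoc t = m ∧ pom t = k}.ncard : ℤ)

/-- The partial difference with respect to the first variable `m`. -/
def diffM (g : ℕ → ℕ → ℤ) (m k : ℕ) : ℤ := g (m + 1) k - g m k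

/-- The partial difference with respect to the second variable `k`. -/
def diffK (g : ℕ → ℕ → ℤ) (m k : ℕ) : ℤ := g m (k + 1) - g m k

/-- There are finitely many trees of bounded height with labels in a finite set. -/
theorem finite_height_le (s : Set ℕ) (hs : s.Finite) (h : ℕ) :
    {t : BinaryTree ℕ | t.height ≤ h ∧ ∀ x ∈ inorder t, x ∈ s}.Finite := by
  induction h with
  | zero =>
    refine (Set.finite_singleton nil).subset ?_
    rintro (_ | ⟨a, l, r⟩) ⟨h1, -⟩
    · rfl
    · simp at h1
  | succ h ih =>
    refine (((hs.prod (ih.prod ih)).image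
      (fun p : ℕ × BinaryTree ℕ × BinaryTree ℕ => node p.1 p.2.1 p.2.2)).insert nil).subset ?_
    rintro (_ | ⟨a, l, r⟩) ⟨h1, h2⟩
    · exact Or.inl rfl
    · simp only [height, add_le_add_iff_right, sup_le_iff] at h1
      simp only [inorder, List.mem_append, List.mem_cons] at h2
      exact Or.inr ⟨(a, l, r), ⟨h2 a (by simp), ⟨h1.1, fun x hx => h2 x (by simp [hx])⟩,
        ⟨h1.2, fun x hx => h2 x (by simp [hx])⟩⟩, rfl⟩

theorem length_inorder (t : BinaryTree ℕ) : (inorder t).length = t.numNodes := by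
  induction t with
  | nil => rfl
  | node a l r hl hr => simp [inorder, hl, hr]; omega

/-- The set of complete increasing trees of size `n` is finite, so that the numbers `f n m k` are
true cardinalities. -/
theorem completeTrees_finite (n : ℕ) : (completeTrees n).Finite := by
  refine (finite_height_le {x | x < n + 1} (Set.finite_lt_nat _) n).subset ?_
  rintro t ⟨⟨hp, -⟩, -⟩
  refine ⟨?_, fun x hx => ?_⟩
  · have := hp.length_eq
    rw [length_inorder, List.length_range'] at this
    exact this ▸ t.height_le_numNodes
  · have := hp.mem_iff.1 hx
    simp only [List.mem_range'_1] at this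
    simp only [Set.mem_ofPred_eq]
    omega

end SecantTree

/-! Both relations follow from one bijective scheme. A first difference compares trees that an
exchange of two consecutive labels matches up: `k` and `k + 1` for `diffK`, `m` and `m + 1` for
`diffM`. Where the exchange is admissible, the contributions cancel. The exceptions are concentrated
at a single node `x`. For the positive term, a child `y` of `x` has a leaf `z` as child ("grown");
for the negative term, the two new labels are the two children of `x`, and one of them is a leaf
("pushed"). Deleting the two labels and hanging the remaining subtrees back on `x` yields a tree
with two nodes fewer, cut at `x`.

Completeness is encoded by `OddLeft`, a condition on left subtrees that covers both parities of the
size and is insensitive to adding two nodes. Among the smaller cut trees, let A count those where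
`x` has a left child, B those where `x` is a leaf, and C those where both subtrees of `x` are odd.
Parity leaves 3A + C ways to grow and A + 2B + C ways to push, so the difference is 2A - 2B = 2(A +
B) - 4B (`ncard_grown_add`).

For `diffK`, `x` is the node `k` and the labels inserted are `k + 1` and the maximum `N`. This gives
`diffK_f_eq`: twice the number of trees with `eoc = m`, minus four times those in which moreover `k`
is a leaf. In the second difference only "`k + 1` is a leaf" versus "`k` is a leaf" remains. A
further exchange cancels all trees except those with a leaf `k + 1` below `k`, and raising this leaf
to the maximum makes them the trees with `pom = k`.

For `diffM`, `x` is the last node of the minimal chain with label below `m`, and the labels inserted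
are `m` and `m + 1`. Here `x` is a leaf exactly when `eoc < m`, which gives `diffM_f_eq`; in the
second difference only `eoc = m` is left. Neither argument uses that the size is even. -/

namespace SecantTree

open BinaryTree

/-! ### Labels, parent-child pairs, and completeness as a parity condition -/

/-- The multiset of the labels of a tree. -/
def labels : BinaryTree ℕ → Multiset ℕ
  | nil => 0
  | node a l r => a ::ₘ (labels l + labels r)

theorem labels_eq_coe_inorder (t : BinaryTree ℕ) : labels t = (inorder t : Multiset ℕ) := by
  induction t with
  | nil => rfl
  | node a l r hl hr =>
    simp only [labels, inorder, hl, hr, Multiset.coe_add, Multiset.cons_coe, Multiset.coe_eq_coe]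
    exact List.perm_middle.symm

theorem card_labels (t : BinaryTree ℕ) : Multiset.card (labels t) = t.numNodes := by
  rw [labels_eq_coe_inorder, Multiset.coe_card, length_inorder]

theorem mem_labels_of_root? {t : BinaryTree ℕ} {b : ℕ} (h : root? t = some b) : b ∈ labels t := by
  cases t with
  | nil => simp [root?] at h
  | node a l r =>
    have : a = b := by simpa [root?] using h
    simp [labels, this]

theorem root?_eq_none {t : BinaryTree ℕ} : root? t = none ↔ t = nil := by
  cases t <;> simp [root?]

/-- In the tree, some node labelled `b` is a child of a node labelled `a`. -/
def IsChild (a b : ℕ) : BinaryTree ℕ → Prop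
  | nil => False
  | node x l r => (x = a ∧ (root? l = some b ∨ root? r = some b)) ∨ IsChild a b l ∨ IsChild a b r

/-- In terms of edges, monotonicity after a relabeling can be checked one edge at a time. -/
theorem labelsIncrease_iff {t : BinaryTree ℕ} :
    LabelsIncrease t ↔ ∀ a b, IsChild a b t → a < b := by
  induction t with
  | nil => simp [LabelsIncrease, IsChild]
  | node x l r hl hr =>
    simp only [LabelsIncrease, IsChild, hl, hr]
    constructor
    · rintro ⟨h1, h2, h3, h4⟩ a b (⟨rfl, h | h⟩ | h | h)
      · exact h1 _ h
      · exact h2 _ h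
      · exact h3 _ _ h
      · exact h4 _ _ h
    · intro h
      exact ⟨fun b hb => h _ _ (.inl ⟨rfl, .inl hb⟩), fun b hb => h _ _ (.inl ⟨rfl, .inr hb⟩),
        fun a b hb => h _ _ (.inr (.inl hb)), fun a b hb => h _ _ (.inr (.inr hb))⟩

theorem IsChild.mem {a b : ℕ} {t : BinaryTree ℕ} (h : IsChild a b t) :
    a ∈ labels t ∧ b ∈ labels t := by
  induction t with
  | nil => exact h.elim
  | node x l r hl hr =>
    simp only [labels, Multiset.mem_cons, Multiset.mem_add]
    rcases h with ⟨rfl, h | h⟩ | h | h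
    · exact ⟨.inl rfl, .inr (.inl (mem_labels_of_root? h))⟩
    · exact ⟨.inl rfl, .inr (.inr (mem_labels_of_root? h))⟩
    · exact ⟨.inr (.inl (hl h).1), .inr (.inl (hl h).2)⟩
    · exact ⟨.inr (.inr (hr h).1), .inr (.inr (hr h).2)⟩

theorem LabelsIncrease.root_le {t : BinaryTree ℕ} (h : LabelsIncrease t) {a b : ℕ}
    (ha : root? t = some a) (hb : b ∈ labels t) : a ≤ b := by
  induction t generalizing a with
  | nil => simp [root?] at ha
  | node x l r hl hr =>
    obtain rfl : x = a := by simpa [root?] using ha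
    obtain ⟨h1, h2, h3, h4⟩ := h
    simp only [labels, Multiset.mem_cons, Multiset.mem_add] at hb
    rcases hb with rfl | hb | hb
    · exact le_rfl
    · cases l with
      | nil => simp [labels] at hb
      | node y l1 l2 => exact (h1 y rfl).le.trans (hl h3 rfl hb)
    · cases r with
      | nil => simp [labels] at hb
      | node y l1 l2 => exact (h2 y rfl).le.trans (hr h4 rfl hb)

/-- A parity form of completeness: each node is a leaf, or has a left subtree of odd size. -/
def OddLeft : BinaryTree ℕ → Prop
  | nil => True
  | node _ l r => (Odd l.numNodes ∨ (l = nil ∧ r = nil)) ∧ OddLeft l ∧ OddLeft r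

/-- Nonempty full trees have odd size. Conversely, an odd total and an odd left subtree force an
odd, hence nonempty, right subtree. -/
theorem isFull_iff {t : BinaryTree ℕ} :
    IsFull t ↔ OddLeft t ∧ (t = nil ∨ Odd t.numNodes) := by
  induction t with
  | nil => simp [IsFull, OddLeft]
  | node a l r hl hr =>
    simp only [IsFull, OddLeft, hl, hr, numNodes, Nat.odd_iff, reduceCtorEq, false_or]
    by_cases h : l = nil <;> by_cases h' : r = nil
    · simp [h, h']
    · simp only [h, h', numNodes]
      simp
    · simp only [h, h', numNodes]
      simp
      omega
    · simp only [h, h', iff_self, true_and, false_or, and_self, or_false]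
      constructor
      · rintro ⟨⟨h1, h2⟩, h3, h4⟩
        exact ⟨⟨h2, h1, h3⟩, by omega⟩
      · rintro ⟨⟨h1, h2, h3⟩, h4⟩
        exact ⟨⟨h2, h1⟩, h3, by omega⟩

/-- Left subtrees along the right spine are full, so a nonempty one is odd and together with its
spine node accounts for an even number of nodes. Only the rightmost node decides the parity of the
size, in agreement with the parity clause. -/
theorem isFullExceptRightmost_iff {t : BinaryTree ℕ} (ht : t ≠ nil) :
    (IsFullExceptRightmost t ∧ ((rightmost t).left ≠ nil ↔ Even t.numNodes)) ↔ OddLeft t := by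
  induction t with
  | nil => exact absurd rfl ht
  | node a l r hl hr =>
    clear hl
    simp only [IsFullExceptRightmost, OddLeft, isFull_iff]
    cases r with
    | nil =>
      clear hr
      by_cases h : l = nil
      · simp [h, OddLeft, rightmost, BinaryTree.left, IsFullExceptRightmost]
      · simp [h, OddLeft, rightmost, BinaryTree.left, IsFullExceptRightmost, Nat.even_add_one]
        exact and_comm
    | node b l' r' =>
      rw [← hr (by simp)]
      by_cases h : l = nil
      · simp [h]
      · simp only [rightmost, numNodes, h, ne_eq, reduceCtorEq, not_false_eq_true, imp_self,
          false_or, true_and, false_and, or_false, Nat.odd_iff, Nat.even_iff]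
        constructor
        · rintro ⟨⟨⟨h1, h2⟩, h3⟩, h4⟩
          exact ⟨h2, h1, h3, h4.trans (by omega)⟩
        · rintro ⟨h2, h1, h3, h4⟩
          exact ⟨⟨⟨h1, h2⟩, h3⟩, h4.trans (by omega)⟩

/-- The complete increasing trees with a given multiset of labels. -/
def Good (S : Multiset ℕ) (t : BinaryTree ℕ) : Prop :=
  labels t = S ∧ LabelsIncrease t ∧ OddLeft t

theorem finite_good (S : Multiset ℕ) : {t | Good S t}.Finite := by
  refine (finite_height_le {x | x ∈ S} (Multiset.finite_toSet S) (Multiset.card S)).subset ?_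
  rintro t ⟨rfl, -⟩
  refine ⟨?_, fun x hx => ?_⟩
  · rw [card_labels]
    exact t.height_le_numNodes
  · simpa [labels_eq_coe_inorder] using hx

theorem isCompleteIncreasing_iff {n : ℕ} (hn : n ≠ 0) {t : BinaryTree ℕ} :
    IsCompleteIncreasing n t ↔ Good (Finset.Icc 1 n).val t := by
  have key : (inorder t).Perm (List.range' 1 n) ↔ labels t = (Finset.Icc 1 n).val := by
    rw [labels_eq_coe_inorder, ← Multiset.coe_eq_coe]
    rfl
  unfold IsCompleteIncreasing IsIncreasing Good
  rw [key]
  constructor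
  · rintro ⟨⟨h1, h2⟩, h3⟩
    have hc : t.numNodes = n := by rw [← card_labels, h1]; simp
    refine ⟨h1, h2, (isFullExceptRightmost_iff ?_).1 (hc ▸ h3)⟩
    rintro rfl
    exact hn hc.symm
  · rintro ⟨h1, h2, h3⟩
    have hc : t.numNodes = n := by rw [← card_labels, h1]; simp
    refine ⟨⟨h1, h2⟩, ?_⟩
    have := (isFullExceptRightmost_iff (t := t) ?_).2 h3
    · rwa [hc] at this
    · rintro rfl
      exact hn hc.symm

/-- Distinct labels make the left-first search unambiguous, so the computed parent is the only one.
-/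
theorem parent?_eq_some {x k : ℕ} {t : BinaryTree ℕ} (ht : (labels t).Nodup)
    (hi : LabelsIncrease t) : parent? x t = some k ↔ IsChild k x t := by
  induction t generalizing k with
  | nil => simp [parent?, IsChild]
  | node a l r hl hr =>
    simp only [labels, Multiset.nodup_cons, Multiset.nodup_add] at ht
    obtain ⟨-, h1, h2, h3⟩ := ht
    obtain ⟨-, -, h4, h5⟩ := hi
    have hlr : ∀ y, y ∈ labels l → y ∈ labels r → False := fun y hy hy' =>
      Multiset.disjoint_left.1 h3 hy hy'
    replace hl := fun k => @hl k h1 h4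
    replace hr := fun k => @hr k h2 h5
    simp only [parent?, IsChild]
    have nochild : ∀ {t : BinaryTree ℕ}, LabelsIncrease t → root? t = some x →
        ¬ IsChild k x t := fun hi h h' =>
      absurd (hi.root_le h h'.mem.1) (labelsIncrease_iff.1 hi _ _ h').not_ge
    split_ifs with h
    · simp only [Option.some.injEq]
      constructor
      · intro h'
        exact .inl ⟨h', h⟩
      · rintro (⟨h', -⟩ | h' | h')
        · exact h'
        · exfalso
          rcases h with h | h
          · exact nochild h4 h h'
          · exact hlr x h'.mem.2 (mem_labels_of_root? h)
        · exfalso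
          rcases h with h | h
          · exact hlr x (mem_labels_of_root? h) h'.mem.2
          · exact nochild h5 h h'
    · rw [Option.or_eq_some_iff, hl, hr]
      constructor
      · rintro (h' | ⟨-, h'⟩)
        · exact .inr (.inl h')
        · exact .inr (.inr h')
      · rintro (⟨-, h'⟩ | h' | h')
        · exact absurd h' h
        · exact .inl h'
        · refine .inr ⟨?_, h'⟩
          rw [Option.eq_none_iff_forall_ne_some]
          intro k' hk'
          exact hlr x ((hl k').1 hk').mem.2 h'.mem.2

/-- The value `0` of `pom` is the default for a missing parent, whence `k ≠ 0`. -/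
theorem f_eq {n m k : ℕ} (hn : n ≠ 0) (hk : k ≠ 0) :
    f n m k = ({t | Good (Finset.Icc 1 n).val t ∧ eoc t = m ∧ IsChild k n t}.ncard : ℤ) := by
  unfold f
  congr 2
  ext t
  change IsCompleteIncreasing n t ∧ _ ↔ _ ∧ _
  rw [isCompleteIncreasing_iff hn]
  refine and_congr_right fun h => and_congr_right fun _ => ?_
  have hc : t.numNodes = n := by rw [← card_labels, h.1]; simp
  rw [← parent?_eq_some (by rw [h.1]; exact Finset.nodup _) h.2.1, pom, hc]
  cases parent? n t
  · simp [hk.symm]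
  · simp

/-! ### The minimal chain -/

theorem eoc_of_lt {a b : ℕ} {l r : BinaryTree ℕ} (hl : root? l = some b)
    (hr : ∀ c, root? r = some c → b < c) : eoc (node a l r) = eoc l := by
  cases l with
  | nil => simp [root?] at hl
  | node b' l1 l2 =>
    obtain rfl : b' = b := by simpa [root?] using hl
    cases r with
    | nil => rfl
    | node c r1 r2 => simp [eoc, hr c rfl]

theorem eoc_of_le {a c : ℕ} {l r : BinaryTree ℕ} (hr : root? r = some c)
    (hl : ∀ b, root? l = some b → c ≤ b) : eoc (node a l r) = eoc r := by
  cases r with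
  | nil => simp [root?] at hr
  | node c' r1 r2 =>
    obtain rfl : c' = c := by simpa [root?] using hr
    cases l with
    | nil => rfl
    | node b l1 l2 => simp [eoc, hl b rfl]

/-- A node is a leaf, or the minimal chain goes to the left, or it goes to the right. -/
theorem minimal_child_cases (l r : BinaryTree ℕ) :
    (l = nil ∧ r = nil) ∨ (∃ b, root? l = some b ∧ ∀ c, root? r = some c → b < c) ∨
      ∃ c, root? r = some c ∧ ∀ b, root? l = some b → c ≤ b := by
  cases l with
  | nil =>
    cases r with
    | nil => simp
    | node c r1 r2 => simp [root?]
  | node b l1 l2 =>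
    cases r with
    | nil => simp [root?]
    | node c r1 r2 =>
      simp only [root?, Option.some.injEq, forall_eq', exists_eq_left']
      exact .inr (lt_or_ge b c)

theorem eoc_mem {t : BinaryTree ℕ} (ht : t ≠ nil) : eoc t ∈ labels t := by
  induction t with
  | nil => exact absurd rfl ht
  | node a l r hl hr =>
    simp only [labels, Multiset.mem_cons, Multiset.mem_add]
    rcases minimal_child_cases l r with ⟨rfl, rfl⟩ | ⟨b, hb, h⟩ | ⟨c, hc, h⟩
    · exact .inl rfl
    · rw [eoc_of_lt hb h]
      refine .inr (.inl (hl ?_))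
      rintro rfl
      simp [root?] at hb
    · rw [eoc_of_le hc h]
      refine .inr (.inr (hr ?_))
      rintro rfl
      simp [root?] at hc

theorem LabelsIncrease.root_le_eoc {t : BinaryTree ℕ} (h : LabelsIncrease t) {a : ℕ}
    (ha : root? t = some a) : a ≤ eoc t :=
  h.root_le ha (eoc_mem (by rintro rfl; simp [root?] at ha))

/-! ### One-hole contexts -/

/-- A binary tree with a hole in place of a subtree. -/
inductive Ctx : Type
  | hole : Ctx
  | left (a : ℕ) (c : Ctx) (r : BinaryTree ℕ) : Ctx
  | right (a : ℕ) (l : BinaryTree ℕ) (c : Ctx) : Ctx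

/-- Put a tree in the hole of a context. -/
def fill : Ctx → BinaryTree ℕ → BinaryTree ℕ
  | .hole, s => s
  | .left a c r, s => node a (fill c s) r
  | .right a l c, s => node a l (fill c s)

/-- The label of the root of the tree obtained by filling a context with a tree of root `p`. -/
def Ctx.head : Ctx → ℕ → ℕ
  | .hole, p => p
  | .left a _ _, _ => a
  | .right a _ _, _ => a

/-- The labels outside the hole of a context. -/
def Ctx.labels : Ctx → Multiset ℕ
  | .hole => 0
  | .left a c r => a ::ₘ (c.labels + SecantTree.labels r)
  | .right a l c => a ::ₘ (SecantTree.labels l + c.labels)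

/-- If the hole is filled with a tree of root `p`, then the minimal chain goes through `p`. -/
def Ctx.OnChain : Ctx → ℕ → Prop
  | .hole, _ => True
  | .left _ c r, p => c.OnChain p ∧ ∀ b, root? r = some b → c.head p < b
  | .right _ l c, p => c.OnChain p ∧ ∀ b, root? l = some b → c.head p ≤ b

theorem root?_fill {c : Ctx} {s : BinaryTree ℕ} {p : ℕ} (h : root? s = some p) :
    root? (fill c s) = some (c.head p) := by
  cases c with
  | hole => exact h
  | left a c r => rfl
  | right a l c => rfl

theorem fill_eq_nil {c : Ctx} {s : BinaryTree ℕ} : fill c s = nil ↔ c = .hole ∧ s = nil := by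
  cases c <;> simp [fill]

theorem labels_fill (c : Ctx) (s : BinaryTree ℕ) : labels (fill c s) = c.labels + labels s := by
  induction c with
  | hole => simp [fill, Ctx.labels]
  | left a c r ih => simp [fill, Ctx.labels, labels, ih, add_right_comm]
  | right a l c ih => simp [fill, Ctx.labels, labels, ih, add_assoc]

theorem eoc_fill {c : Ctx} {s : BinaryTree ℕ} {p : ℕ} (hs : root? s = some p)
    (hc : c.OnChain p) : eoc (fill c s) = eoc s := by
  induction c with
  | hole => rfl
  | left a c r ih => rw [fill, eoc_of_lt (root?_fill hs) hc.2, ih hc.1]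
  | right a l c ih => rw [fill, eoc_of_le (root?_fill hs) hc.2, ih hc.1]

/-- The two fillings have the same root, so the chain enters both or neither. If it enters, neither
end is `m`; if not, the end is the same. -/
theorem eoc_fill_eq_iff {c : Ctx} {s s' : BinaryTree ℕ} {p m : ℕ} (hs : root? s = some p)
    (hs' : root? s' = some p) (h : eoc s ≠ m) (h' : eoc s' ≠ m) :
    eoc (fill c s) = m ↔ eoc (fill c s') = m := by
  induction c with
  | hole => exact iff_of_false h h'
  | left a c r ih =>
    simp only [fill]
    rcases minimal_child_cases (fill c s) r with ⟨h0, -⟩ | ⟨b, hb, hr⟩ | ⟨b, hb, hl⟩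
    · have := root?_fill (c := c) hs
      simp [h0, root?] at this
    · rw [eoc_of_lt hb hr, eoc_of_lt (b := b) _ hr, ih]
      rw [root?_fill hs', ← hb, root?_fill hs]
    · rw [eoc_of_le hb hl, eoc_of_le hb]
      rwa [root?_fill hs', ← root?_fill hs]
  | right a l c ih =>
    simp only [fill]
    rcases minimal_child_cases l (fill c s) with ⟨-, h0⟩ | ⟨b, hb, hr⟩ | ⟨b, hb, hl⟩
    · have := root?_fill (c := c) hs
      simp [h0, root?] at this
    · rw [eoc_of_lt hb hr, eoc_of_lt hb]
      rwa [root?_fill hs', ← root?_fill hs]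
    · rw [eoc_of_le hb hl, eoc_of_le (c := b) _ hl, ih]
      rw [root?_fill hs', ← hb, root?_fill hs]

theorem isChild_fill_iff {c : Ctx} {s : BinaryTree ℕ} {p a b : ℕ} (hs : root? s = some p) :
    IsChild a b (fill c s) ↔ IsChild a b (fill c (node p nil nil)) ∨ IsChild a b s := by
  induction c with
  | hole => simp [fill, IsChild, root?]
  | left x c r ih =>
    simp only [fill, IsChild, ih, root?_fill hs, root?_fill (s := node p nil nil) rfl]
    tauto
  | right x l c ih =>
    simp only [fill, IsChild, ih, root?_fill hs, root?_fill (s := node p nil nil) rfl]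
    tauto

theorem LabelsIncrease.of_fill {c : Ctx} {s : BinaryTree ℕ} (h : LabelsIncrease (fill c s)) :
    LabelsIncrease s := by
  induction c with
  | hole => exact h
  | left a c r ih => exact ih h.2.2.1
  | right a l c ih => exact ih h.2.2.2

theorem LabelsIncrease.fill_congr {c : Ctx} {s s' : BinaryTree ℕ} {p : ℕ}
    (hs : root? s = some p) (hs' : root? s' = some p) (h : LabelsIncrease (fill c s))
    (h' : LabelsIncrease s') : LabelsIncrease (fill c s') := by
  induction c with
  | hole => exact h'
  | left a c r ih =>
    obtain ⟨h1, h2, h3, h4⟩ := h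
    exact ⟨by rwa [root?_fill hs', ← root?_fill hs], h2, ih h3, h4⟩
  | right a l c ih =>
    obtain ⟨h1, h2, h3, h4⟩ := h
    exact ⟨h1, by rwa [root?_fill hs', ← root?_fill hs], h3, ih h4⟩

theorem numNodes_fill_parity {c : Ctx} {s s' : BinaryTree ℕ}
    (hp : s.numNodes % 2 = s'.numNodes % 2) :
    (fill c s).numNodes % 2 = (fill c s').numNodes % 2 := by
  induction c with
  | hole => exact hp
  | left a c r ih => simp only [fill, numNodes]; omega
  | right a l c ih => simp only [fill, numNodes]; omega

theorem OddLeft.of_fill {c : Ctx} {s : BinaryTree ℕ} (h : OddLeft (fill c s)) : OddLeft s := by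
  induction c with
  | hole => exact h
  | left a c r ih => exact ih h.2.1
  | right a l c ih => exact ih h.2.2

theorem OddLeft.fill_congr {c : Ctx} {s s' : BinaryTree ℕ} (hs : s ≠ nil) (hs' : s' ≠ nil)
    (hp : s.numNodes % 2 = s'.numNodes % 2) (h : OddLeft (fill c s)) (h' : OddLeft s') :
    OddLeft (fill c s') := by
  induction c with
  | hole => exact h'
  | left a c r ih =>
    obtain ⟨h1, h2, h3⟩ := h
    refine ⟨?_, ih h2, h3⟩
    have := numNodes_fill_parity (c := c) hp
    simpa only [fill_eq_nil, hs, hs', and_false, false_and, or_false, Nat.odd_iff, this] using h1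
  | right a l c ih =>
    obtain ⟨h1, h2, h3⟩ := h
    refine ⟨?_, h2, ih h3⟩
    simpa only [fill_eq_nil, hs, hs', and_false] using h1

/-- Surgery inside a context: replacing a subtree by another one with the same root and two more
nodes. -/
theorem good_fill_iff {c : Ctx} {s s' : BinaryTree ℕ} {p : ℕ} {S T : Multiset ℕ}
    (hs : root? s = some p) (hs' : root? s' = some p)
    (hl : labels s' = T + labels s) (hT : Even (Multiset.card T))
    (h : LabelsIncrease s ∧ OddLeft s ↔ LabelsIncrease s' ∧ OddLeft s') :
    Good S (fill c s) ↔ Good (T + S) (fill c s') := by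
  have h1 : s ≠ nil := by rintro rfl; simp [root?] at hs
  have h2 : s' ≠ nil := by rintro rfl; simp [root?] at hs'
  have hp : s.numNodes % 2 = s'.numNodes % 2 := by
    rw [← card_labels, ← card_labels, hl, Multiset.card_add]
    rw [Nat.even_iff] at hT
    omega
  unfold Good
  rw [labels_fill, labels_fill, hl, add_left_comm, add_right_inj]
  refine and_congr_right fun _ => ⟨fun ⟨ha, hb⟩ => ?_, fun ⟨ha, hb⟩ => ?_⟩
  · obtain ⟨hc, hd⟩ := h.1 ⟨ha.of_fill, hb.of_fill⟩
    exact ⟨ha.fill_congr hs hs' hc, hb.fill_congr h1 h2 hp hd⟩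
  · obtain ⟨hc, hd⟩ := h.2 ⟨ha.of_fill, hb.of_fill⟩
    exact ⟨ha.fill_congr hs' hs hc, hb.fill_congr h2 h1 hp.symm hd⟩

theorem exists_fill_of_mem {t : BinaryTree ℕ} {x : ℕ} (h : x ∈ labels t) :
    ∃ c l r, t = fill c (node x l r) := by
  induction t with
  | nil => simp [labels] at h
  | node a l r hl hr =>
    simp only [labels, Multiset.mem_cons, Multiset.mem_add] at h
    rcases h with rfl | h | h
    · exact ⟨.hole, l, r, rfl⟩
    · obtain ⟨c, l', r', rfl⟩ := hl h
      exact ⟨.left a c r, l', r', rfl⟩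
    · obtain ⟨c, l', r', rfl⟩ := hr h
      exact ⟨.right a l c, l', r', rfl⟩

/-- A label occurring once determines its position, so cutting at a given label loses nothing in
counting. -/
theorem fill_node_inj {c c' : Ctx} {x : ℕ} {l r l' r' : BinaryTree ℕ}
    (h : fill c (node x l r) = fill c' (node x l' r')) (hn : (labels (fill c (node x l r))).Nodup) :
    c = c' ∧ l = l' ∧ r = r' := by
  have hm : ∀ c l r, x ∈ labels (fill c (node x l r)) := fun c l r => by simp [labels_fill, labels]
  induction c generalizing c' with
  | hole =>
    cases c' with
    | hole => simpa [fill] using h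
    | left a c' r1 =>
      simp only [fill, node.injEq] at h
      simp only [fill, labels, Multiset.nodup_cons, Multiset.mem_add] at hn
      exact absurd (.inl (by rw [h.2.1]; exact hm _ _ _)) hn.1
    | right a l1 c' =>
      simp only [fill, node.injEq] at h
      simp only [fill, labels, Multiset.nodup_cons, Multiset.mem_add] at hn
      exact absurd (.inr (by rw [h.2.2]; exact hm _ _ _)) hn.1
  | left a c r1 ih =>
    simp only [fill, labels, Multiset.nodup_cons, Multiset.mem_add, Multiset.nodup_add] at hn
    obtain ⟨h1, h2, h3, h4⟩ := hn
    cases c' with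
    | hole =>
      simp only [fill, node.injEq] at h
      obtain ⟨rfl, -⟩ := h
      exact absurd (.inl (hm _ _ _)) h1
    | left a' c' r1' =>
      simp only [fill, node.injEq] at h
      obtain ⟨rfl, h5, rfl⟩ := h
      obtain ⟨rfl, h6⟩ := ih h5 h2
      exact ⟨rfl, h6⟩
    | right a' l1' c' =>
      simp only [fill, node.injEq] at h
      exact absurd (h.2.2 ▸ hm _ _ _) (Multiset.disjoint_left.1 h4 (hm _ _ _))
  | right a l1 c ih =>
    simp only [fill, labels, Multiset.nodup_cons, Multiset.mem_add, Multiset.nodup_add] at hn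
    obtain ⟨h1, h2, h3, h4⟩ := hn
    cases c' with
    | hole =>
      simp only [fill, node.injEq] at h
      obtain ⟨rfl, -⟩ := h
      exact absurd (.inr (hm _ _ _)) h1
    | left a' c' r1' =>
      simp only [fill, node.injEq] at h
      exact absurd (hm _ _ _) (Multiset.disjoint_left.1 h4 (h.2.1 ▸ hm _ _ _))
    | right a' l1' c' =>
      simp only [fill, node.injEq] at h
      obtain ⟨rfl, rfl, h5⟩ := h
      obtain ⟨rfl, h6⟩ := ih h5 h3
      exact ⟨rfl, h6⟩

theorem LabelsIncrease.head_le {c : Ctx} {s : BinaryTree ℕ} {p : ℕ} (hs : root? s = some p)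
    (h : LabelsIncrease (fill c s)) : c.head p ≤ p :=
  h.root_le (root?_fill hs)
    (by rw [labels_fill]; exact Multiset.mem_add.2 (.inr (mem_labels_of_root? hs)))

/-- The minimal chain can be cut after its last label smaller than `m`. -/
theorem exists_fill_onChain {t : BinaryTree ℕ} {a m : ℕ} (ha : root? t = some a) (ham : a < m) :
    ∃ c p l r, t = fill c (node p l r) ∧ c.OnChain p ∧ p < m ∧
      (∀ b, root? l = some b → m ≤ b) ∧ (∀ b, root? r = some b → m ≤ b) := by
  induction t generalizing a with
  | nil => simp [root?] at ha
  | node a' l r hl hr =>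
    obtain rfl : a' = a := by simpa [root?] using ha
    rcases minimal_child_cases l r with ⟨rfl, rfl⟩ | ⟨b, hb, h⟩ | ⟨b, hb, h⟩
    · exact ⟨.hole, a', nil, nil, rfl, trivial, ham, by simp [root?], by simp [root?]⟩
    · by_cases hbm : b < m
      · obtain ⟨c, p, l', r', rfl, h1, h2⟩ := hl hb hbm
        rw [root?_fill rfl, Option.some.injEq] at hb
        exact ⟨.left a' c r, p, l', r', rfl, ⟨h1, hb ▸ h⟩, h2⟩
      · refine ⟨.hole, a', l, r, rfl, trivial, ham, ?_, fun d hd => ?_⟩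
        · rw [hb]; simpa using hbm
        · have := h d hd; omega
    · by_cases hbm : b < m
      · obtain ⟨c, p, l', r', rfl, h1, h2⟩ := hr hb hbm
        rw [root?_fill rfl, Option.some.injEq] at hb
        exact ⟨.right a' l c, p, l', r', rfl, ⟨h1, hb ▸ h⟩, h2⟩
      · refine ⟨.hole, a', l, r, rfl, trivial, ham, fun d hd => ?_, ?_⟩
        · have := h d hd; omega
        · rw [hb]; simpa using hbm

/-- Both cuts lie on the same chain. If one stopped earlier, its children would be at least `m`,
whereas the other cut lies below one of them with a label less than `m`. -/
theorem fill_onChain_inj {c c' : Ctx} {p p' m : ℕ} {l r l' r' : BinaryTree ℕ}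
    (h : fill c (node p l r) = fill c' (node p' l' r'))
    (hi : LabelsIncrease (fill c (node p l r)))
    (hc : c.OnChain p) (hc' : c'.OnChain p') (hp : p < m) (hp' : p' < m)
    (hl : ∀ b, root? l = some b → m ≤ b) (hr : ∀ b, root? r = some b → m ≤ b)
    (hl' : ∀ b, root? l' = some b → m ≤ b) (hr' : ∀ b, root? r' = some b → m ≤ b) :
    c = c' ∧ p = p' ∧ l = l' ∧ r = r' := by
  have hm : ∀ {c p l r}, LabelsIncrease (fill c (node p l r)) → p < m →
      (∀ b, root? (fill c (node p l r)) = some b → m ≤ b) → False := fun {c p l r} h1 h2 h3 =>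
    absurd ((h3 _ (root?_fill rfl)).trans (h1.head_le rfl)) h2.not_ge
  induction c generalizing c' with
  | hole =>
    cases c' with
    | hole => simpa [fill] using h
    | left a c' r1 =>
      simp only [fill, node.injEq] at h hi
      obtain ⟨rfl, rfl, rfl⟩ := h
      exact (hm hi.2.2.1 hp' hl).elim
    | right a l1 c' =>
      simp only [fill, node.injEq] at h hi
      obtain ⟨rfl, rfl, rfl⟩ := h
      exact (hm hi.2.2.2 hp' hr).elim
  | left a c r1 ih =>
    cases c' with
    | hole =>
      simp only [fill, node.injEq] at h hi
      obtain ⟨rfl, rfl, rfl⟩ := h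
      exact (hm hi.2.2.1 hp hl').elim
    | left a' c' r1' =>
      simp only [fill, node.injEq] at h
      obtain ⟨rfl, h5, rfl⟩ := h
      obtain ⟨rfl, h6⟩ := ih h5 hi.2.2.1 hc.1 hc'.1
      exact ⟨rfl, h6⟩
    | right a' l1' c' =>
      simp only [fill, node.injEq] at h
      obtain ⟨rfl, rfl, rfl⟩ := h
      exact absurd (hc.2 _ (root?_fill rfl)) (hc'.2 _ (root?_fill rfl)).not_gt
  | right a l1 c ih =>
    cases c' with
    | hole =>
      simp only [fill, node.injEq] at h hi
      obtain ⟨rfl, rfl, rfl⟩ := h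
      exact (hm hi.2.2.2 hp hr').elim
    | left a' c' r1' =>
      simp only [fill, node.injEq] at h
      obtain ⟨rfl, rfl, rfl⟩ := h
      exact absurd (hc'.2 _ (root?_fill rfl)) (hc.2 _ (root?_fill rfl)).not_gt
    | right a' l1' c' =>
      simp only [fill, node.injEq] at h
      obtain ⟨rfl, rfl, h5⟩ := h
      obtain ⟨rfl, h6⟩ := ih h5 hi.2.2.2 hc.1 hc'.1
      exact ⟨rfl, h6⟩

/-! ### Cuts and surgery -/

theorem root?_nil : root? nil = none := rfl

theorem root?_node (a : ℕ) (l r : BinaryTree ℕ) : root? (node a l r) = some a := rfl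

theorem numNodes_eq_zero {t : BinaryTree ℕ} : t.numNodes = 0 ↔ t = nil := by
  cases t <;> simp

/-- A tree cut at a node: the context of this node, its label and its two subtrees. -/
@[ext]
structure Cut where
  ctx : Ctx
  x : ℕ
  l : BinaryTree ℕ
  r : BinaryTree ℕ

/-- The tree from which a cut is made. -/
def Cut.toTree (q : Cut) : BinaryTree ℕ := fill q.ctx (node q.x q.l q.r)

/-- The cuts of complete increasing trees at a node labelled less than `y` with no child labelled
less than `y`, under a condition `M` in which the subtrees only intervene by way of a property
`W`. -/
def cuts (y : ℕ) (M : Ctx → ℕ → Prop → Prop) (W : BinaryTree ℕ → Prop) (S : Multiset ℕ) :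
    Set Cut :=
  {q | Good S q.toTree ∧ M q.ctx q.x (W q.l ∨ W q.r) ∧ q.x < y ∧
    (∀ b, root? q.l = some b → y ≤ b) ∧ ∀ b, root? q.r = some b → y ≤ b}

section surgery

variable {y z y' z' : ℕ} {M : Ctx → ℕ → Prop → Prop} {W : BinaryTree ℕ → Prop} {S : Multiset ℕ}

theorem labels_subset_of_mem_cuts {q : Cut} (hq : q ∈ cuts y M W S) :
    ∀ b, b ∈ labels q.l ∨ b ∈ labels q.r → b ∈ S := by
  intro b hb
  have := hq.1.1
  rw [Cut.toTree, labels_fill] at this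
  simp only [← this, labels, Multiset.mem_add, Multiset.mem_cons]
  exact .inr (.inr hb)

/-- Membership of a cut, under a local modification that adds the labels `y` and `z`. -/
theorem mem_cuts_iff_of_local (hy : y ∉ S) (hz : z ∉ S) {q q' : Cut} {P : Prop}
    (hc : q'.ctx = q.ctx) (hx : q'.x = q.x)
    (hl : labels q'.l + labels q'.r = {y, z} + (labels q.l + labels q.r))
    (hW : W q'.l ∨ W q'.r ↔ W q.l ∨ W q.r)
    (h : q.x < y → (∀ b, root? q.l = some b → b ≠ y ∧ b ≠ z) →
      (∀ b, root? q.r = some b → b ≠ y ∧ b ≠ z) →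
      ((LabelsIncrease (node q.x q.l q.r) ∧ OddLeft (node q.x q.l q.r)) ∧
        ((∀ b, root? q.l = some b → y ≤ b) ∧ ∀ b, root? q.r = some b → y ≤ b) ∧ P ↔
      (LabelsIncrease (node q.x q'.l q'.r) ∧ OddLeft (node q.x q'.l q'.r)) ∧
        (∀ b, root? q'.l = some b → y ≤ b) ∧ ∀ b, root? q'.r = some b → y ≤ b)) :
    q' ∈ cuts y M W ({y, z} + S) ↔ q ∈ cuts y M W S ∧ P := by
  have hl' : labels (node q.x q'.l q'.r) = {y, z} + labels (node q.x q.l q.r) := by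
    simp [labels, hl]
  have hne : ∀ b, b ∈ S → b ≠ y ∧ b ≠ z := fun b hb =>
    ⟨fun h => hy (h ▸ hb), fun h => hz (h ▸ hb)⟩
  -- The local equivalence is a premise because in general it holds only together with `P`. In each
  -- direction below, both of its sides are already known.
  have key : ∀ h : LabelsIncrease (node q.x q.l q.r) ∧ OddLeft (node q.x q.l q.r) ↔
      LabelsIncrease (node q.x q'.l q'.r) ∧ OddLeft (node q.x q'.l q'.r),
      (Good S q.toTree ↔ Good ({y, z} + S) q'.toTree) := fun h => by
    rw [Cut.toTree, Cut.toTree, hc, hx]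
    exact good_fill_iff rfl rfl hl' (by simp) h
  constructor
  · intro hq
    have hS : ∀ b, b ∈ labels q.l ∨ b ∈ labels q.r → b ∈ S := by
      intro b hb
      have := hq.1.1
      rw [Cut.toTree, labels_fill, hc, hx, hl', add_left_comm, add_right_inj] at this
      simp only [← this, labels, Multiset.mem_add, Multiset.mem_cons]
      exact .inr (.inr hb)
    obtain ⟨h1, h2, h3, h4⟩ := hq
    rw [hx] at h3
    have h5 := h1
    rw [Cut.toTree, hx] at h5
    have h6 := h h3 (fun b hb => hne b (hS b (.inl (mem_labels_of_root? hb))))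
      (fun b hb => hne b (hS b (.inr (mem_labels_of_root? hb))))
    have h7 := h6.2 ⟨⟨h5.2.1.of_fill, h5.2.2.of_fill⟩, h4⟩
    refine ⟨⟨(key ⟨fun _ => (h6.1 h7).1, fun _ => h7.1⟩).2 h1, ?_, h3, h7.2.1⟩, h7.2.2⟩
    rwa [hc, hx, hW] at h2
  · rintro ⟨hq, hP⟩
    have hS := labels_subset_of_mem_cuts hq
    obtain ⟨h1, h2, h3, h4⟩ := hq
    have h6 := h h3 (fun b hb => hne b (hS b (.inl (mem_labels_of_root? hb))))
      (fun b hb => hne b (hS b (.inr (mem_labels_of_root? hb))))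
    have h7 : (LabelsIncrease (node q.x q.l q.r) ∧ OddLeft (node q.x q.l q.r)) ∧ _ ∧ P :=
      ⟨⟨h1.2.1.of_fill, h1.2.2.of_fill⟩, h4, hP⟩
    refine ⟨(key ⟨fun _ => (h6.1 h7).1, fun _ => h7.1⟩).1 h1, ?_, hx ▸ h3, (h6.1 h7).2⟩
    rwa [hc, hx, hW]

/-! ### The six ways of inserting two labels at a cut -/

/-- Grow the right child into `y` with left child `z`. -/
def Cut.rightGrowLeft (y z : ℕ) (q : Cut) : Cut :=
  { q with r := node y (node z nil nil) q.r }

/-- Grow the right child into `y` with right child `z`. -/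
def Cut.rightGrowRight (y z : ℕ) (q : Cut) : Cut :=
  { q with r := node y q.r (node z nil nil) }

/-- Grow the left child into `y` with left child `z`. -/
def Cut.leftGrowLeft (y z : ℕ) (q : Cut) : Cut :=
  { q with l := node y (node z nil nil) q.l }

/-- Grow the left child into `y` with right child `z`. -/
def Cut.leftGrowRight (y z : ℕ) (q : Cut) : Cut :=
  { q with l := node y q.l (node z nil nil) }

/-- Move both subtrees to a new right child `y`, with a leaf `z` on the left. -/
def Cut.pushRight (y z : ℕ) (q : Cut) : Cut :=
  { q with l := node z nil nil, r := node y q.l q.r }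

/-- Move both subtrees to a new left child `y`, with a leaf `z` on the right. -/
def Cut.pushLeft (y z : ℕ) (q : Cut) : Cut :=
  { q with l := node y q.l q.r, r := node z nil nil }

/-- The property `W` is inherited from the subtrees for nodes labelled `y`. -/
def Inherits (W : BinaryTree ℕ → Prop) (y : ℕ) : Prop :=
  ∀ l r, W (node y l r) ↔ W l ∨ W r

/-- The leaf `z` makes `y` admissible whatever hangs on its right; the cut node only needs a left
child, since it now has a right one. -/
theorem rightGrowLeft_mem (hy : y ∉ S) (hz : z ∉ S) (hyz : y < z) (h0 : ¬ W nil)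
    (hWy : Inherits W y) (hWz : Inherits W z) {q : Cut} :
    q.rightGrowLeft y z ∈ cuts y M W ({y, z} + S) ↔ q ∈ cuts y M W S ∧ q.l ≠ nil := by
  refine mem_cuts_iff_of_local hy hz rfl rfl ?_ ?_ ?_
  · simp only [Cut.rightGrowLeft, labels, Multiset.insert_eq_cons, ← Multiset.singleton_add, add_zero]
    abel
  · simp [Cut.rightGrowLeft, hWy _ _, hWz _ _, h0]
  · obtain ⟨c, x, l, r⟩ := q
    intro hx hl hr
    have := numNodes_eq_zero (t := l)
    simp only [Cut.rightGrowLeft, root?_node, root?_nil, LabelsIncrease, OddLeft, numNodes, Nat.odd_iff,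
      Option.some.injEq, forall_eq', reduceCtorEq, false_implies, implies_true] at *
    grind

/-- The old right subtree becomes the left subtree of `y`, so it must be odd. This is the one growth
with an additional parity restriction. -/
theorem rightGrowRight_mem (hy : y ∉ S) (hz : z ∉ S) (hyz : y < z) (h0 : ¬ W nil)
    (hWy : Inherits W y) (hWz : Inherits W z) {q : Cut} :
    q.rightGrowRight y z ∈ cuts y M W ({y, z} + S) ↔
      q ∈ cuts y M W S ∧ (q.l ≠ nil ∧ Odd q.r.numNodes) := by
  refine mem_cuts_iff_of_local hy hz rfl rfl ?_ ?_ ?_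
  · simp only [Cut.rightGrowRight, labels, Multiset.insert_eq_cons, ← Multiset.singleton_add, add_zero]
    abel
  · simp [Cut.rightGrowRight, hWy _ _, hWz _ _, h0]
  · obtain ⟨c, x, l, r⟩ := q
    intro hx hl hr
    have := numNodes_eq_zero (t := l)
    simp only [Cut.rightGrowRight, root?_node, root?_nil, LabelsIncrease, OddLeft, numNodes, Nat.odd_iff,
      Option.some.injEq, forall_eq', reduceCtorEq, false_implies, implies_true] at *
    grind

theorem leftGrowLeft_mem (hy : y ∉ S) (hz : z ∉ S) (hyz : y < z) (h0 : ¬ W nil)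
    (hWy : Inherits W y) (hWz : Inherits W z) {q : Cut} :
    q.leftGrowLeft y z ∈ cuts y M W ({y, z} + S) ↔ q ∈ cuts y M W S ∧ q.l ≠ nil := by
  refine mem_cuts_iff_of_local hy hz rfl rfl ?_ ?_ ?_
  · simp only [Cut.leftGrowLeft, labels, Multiset.insert_eq_cons, ← Multiset.singleton_add, add_zero]
    abel
  · simp [Cut.leftGrowLeft, hWy _ _, hWz _ _, h0]
  · obtain ⟨c, x, l, r⟩ := q
    intro hx hl hr
    have := numNodes_eq_zero (t := l)
    simp only [Cut.leftGrowLeft, root?_node, root?_nil, LabelsIncrease, OddLeft, numNodes, Nat.odd_iff,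
      Option.some.injEq, forall_eq', reduceCtorEq, false_implies, implies_true] at *
    grind

theorem leftGrowRight_mem (hy : y ∉ S) (hz : z ∉ S) (hyz : y < z) (h0 : ¬ W nil)
    (hWy : Inherits W y) (hWz : Inherits W z) {q : Cut} :
    q.leftGrowRight y z ∈ cuts y M W ({y, z} + S) ↔ q ∈ cuts y M W S ∧ q.l ≠ nil := by
  refine mem_cuts_iff_of_local hy hz rfl rfl ?_ ?_ ?_
  · simp only [Cut.leftGrowRight, labels, Multiset.insert_eq_cons, ← Multiset.singleton_add, add_zero]
    abel
  · simp [Cut.leftGrowRight, hWy _ _, hWz _ _, h0]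
  · obtain ⟨c, x, l, r⟩ := q
    intro hx hl hr
    have := numNodes_eq_zero (t := l)
    simp only [Cut.leftGrowRight, root?_node, root?_nil, LabelsIncrease, OddLeft, numNodes, Nat.odd_iff,
      Option.some.injEq, forall_eq', reduceCtorEq, false_implies, implies_true] at *
    grind

/-- Always possible: the new left subtree is a single leaf, and `y'` inherits the admissible pair of
subtrees. -/
theorem pushRight_mem (hy : y ∉ S) (hz : z ∉ S) (hyz : y < z)
    (hyz' : (y' = y ∧ z' = z) ∨ (y' = z ∧ z' = y ∧ z = y + 1)) (h0 : ¬ W nil)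
    (hWy : Inherits W y) (hWz : Inherits W z) {q : Cut} :
    q.pushRight y' z' ∈ cuts y M W ({y, z} + S) ↔ q ∈ cuts y M W S := by
  rw [← and_true (q ∈ _)]
  refine mem_cuts_iff_of_local hy hz rfl rfl ?_ ?_ ?_
  · rcases hyz' with ⟨rfl, rfl⟩ | ⟨rfl, rfl, -⟩ <;>
      simp only [Cut.pushRight, labels, Multiset.insert_eq_cons, ← Multiset.singleton_add,
        add_zero] <;> abel
  · rcases hyz' with ⟨rfl, rfl⟩ | ⟨rfl, rfl, -⟩ <;>
      simp [Cut.pushRight, hWy _ _, hWz _ _, h0]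
  · obtain ⟨c, x, l, r⟩ := q
    intro hx hl hr
    have := numNodes_eq_zero (t := l)
    simp only [Cut.pushRight, root?_node, root?_nil, LabelsIncrease, OddLeft, numNodes, Nat.odd_iff,
      Option.some.injEq, forall_eq', reduceCtorEq, false_implies, implies_true] at *
    grind

/-- The whole subtree at `y'` becomes a left subtree and must be odd: the two old subtrees are both
empty or both odd. -/
theorem pushLeft_mem (hy : y ∉ S) (hz : z ∉ S) (hyz : y < z)
    (hyz' : (y' = y ∧ z' = z) ∨ (y' = z ∧ z' = y ∧ z = y + 1)) (h0 : ¬ W nil)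
    (hWy : Inherits W y) (hWz : Inherits W z) {q : Cut} :
    q.pushLeft y' z' ∈ cuts y M W ({y, z} + S) ↔
      q ∈ cuts y M W S ∧ (q.l = nil ∨ Odd q.r.numNodes) := by
  refine mem_cuts_iff_of_local hy hz rfl rfl ?_ ?_ ?_
  · rcases hyz' with ⟨rfl, rfl⟩ | ⟨rfl, rfl, -⟩ <;>
      simp only [Cut.pushLeft, labels, Multiset.insert_eq_cons, ← Multiset.singleton_add,
        add_zero] <;> abel
  · rcases hyz' with ⟨rfl, rfl⟩ | ⟨rfl, rfl, -⟩ <;>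
      simp [Cut.pushLeft, hWy _ _, hWz _ _, h0]
  · obtain ⟨c, x, l, r⟩ := q
    intro hx hl hr
    have hp : ((l.numNodes % 2 = 1 ∨ l = nil ∧ r = nil) ∧ (l = nil ∨ r.numNodes % 2 = 1)) ↔
        (l.numNodes + r.numNodes + 1) % 2 = 1 ∧ (l.numNodes % 2 = 1 ∨ l = nil ∧ r = nil) := by
      rw [← numNodes_eq_zero, ← numNodes_eq_zero]
      omega
    simp only [Cut.pushLeft, root?_node, root?_nil, LabelsIncrease, OddLeft, numNodes, Nat.odd_iff,
      Option.some.injEq, forall_eq', reduceCtorEq, false_implies, implies_true] at *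
    -- The old children avoid `y` and `z`, so being at least `y` means exceeding `y'`, even when `y'
    -- = y + 1`.
    have hr' : (∀ b, root? l = some b → y ≤ b) → ∀ b, root? l = some b → y' < b := by grind
    have hl' : (∀ b, root? r = some b → y ≤ b) → ∀ b, root? r = some b → y' < b := by grind
    have hxl : (∀ b, root? l = some b → y' < b) → ∀ b, root? l = some b → x < b ∧ y ≤ b := by grind
    have hxr : (∀ b, root? r = some b → y' < b) → ∀ b, root? r = some b → x < b ∧ y ≤ b := by grind
    constructor
    · rintro ⟨⟨⟨-, -, h1, h2⟩, h3, h4, h5⟩, ⟨h6, h7⟩, h8⟩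
      obtain ⟨h9, h10⟩ := hp.1 ⟨h3, h8⟩
      exact ⟨⟨⟨by omega, by omega, ⟨hr' h6, hl' h7, h1, h2⟩, by simp⟩, .inl h9,
        ⟨h10, h4, h5⟩, by simp⟩, by omega, by omega⟩
    · rintro ⟨⟨⟨-, -, ⟨h6, h7, h1, h2⟩, -⟩, h9, ⟨h10, h4, h5⟩, -⟩, -⟩
      obtain ⟨h3, h8⟩ := hp.2 ⟨by simpa using h9, h10⟩
      exact ⟨⟨⟨fun b hb => (hxl h6 b hb).1, fun b hb => (hxr h7 b hb).1, h1, h2⟩, h3, h4, h5⟩,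
        ⟨fun b hb => (hxl h6 b hb).2, fun b hb => (hxr h7 b hb).2⟩, h8⟩

/-- The cuts for which one of the two children is `y`, and has a leaf `z` as a child. -/
def Cut.IsGrown (y z : ℕ) (q : Cut) : Prop :=
  (∃ t, q.r = node y (node z nil nil) t) ∨ (∃ t, q.r = node y t (node z nil nil)) ∨
    (∃ t, q.l = node y (node z nil nil) t) ∨ ∃ t, q.l = node y t (node z nil nil)

/-- The cuts for which one of the two children is `y`, and the other one is a leaf `z`. -/
def Cut.IsPushed (y z : ℕ) (q : Cut) : Prop :=
  (∃ t t', q.l = node z nil nil ∧ q.r = node y t t') ∨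
    ∃ t t', q.l = node y t t' ∧ q.r = node z nil nil

/-! ### Counting grown and pushed cuts -/

theorem Cut.rightGrowLeft_injective : (Cut.rightGrowLeft y z).Injective := by
  rintro ⟨c, x, l, r⟩ ⟨c', x', l', r'⟩ h
  simpa [Cut.rightGrowLeft] using h

theorem Cut.rightGrowRight_injective : (Cut.rightGrowRight y z).Injective := by
  rintro ⟨c, x, l, r⟩ ⟨c', x', l', r'⟩ h
  simpa [Cut.rightGrowRight] using h

theorem Cut.leftGrowLeft_injective : (Cut.leftGrowLeft y z).Injective := by
  rintro ⟨c, x, l, r⟩ ⟨c', x', l', r'⟩ h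
  simpa [Cut.leftGrowLeft] using h

theorem Cut.leftGrowRight_injective : (Cut.leftGrowRight y z).Injective := by
  rintro ⟨c, x, l, r⟩ ⟨c', x', l', r'⟩ h
  simpa [Cut.leftGrowRight] using h

theorem Cut.pushRight_injective : (Cut.pushRight y z).Injective := by
  rintro ⟨c, x, l, r⟩ ⟨c', x', l', r'⟩ h
  simpa [Cut.pushRight] using h

theorem Cut.pushLeft_injective : (Cut.pushLeft y z).Injective := by
  rintro ⟨c, x, l, r⟩ ⟨c', x', l', r'⟩ h
  simpa [Cut.pushLeft, and_assoc] using h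

theorem ncard_grown (hfin : (cuts y M W S).Finite) (hy : y ∉ S) (hz : z ∉ S) (hyz : y < z)
    (h0 : ¬ W nil) (hWy : Inherits W y) (hWz : Inherits W z) :
    {q ∈ cuts y M W ({y, z} + S) | q.IsGrown y z}.ncard =
      3 * {q ∈ cuts y M W S | q.l ≠ nil}.ncard +
        {q ∈ cuts y M W S | q.l ≠ nil ∧ Odd q.r.numNodes}.ncard := by
  set K := {q ∈ cuts y M W S | q.l ≠ nil}
  set K' := {q ∈ cuts y M W S | q.l ≠ nil ∧ Odd q.r.numNodes}
  have hK : K.Finite := hfin.subset fun _ h => h.1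
  have hK' : K'.Finite := hfin.subset fun _ h => h.1
  have hyl : ∀ q ∈ cuts y M W S, ∀ t t', q.l ≠ node y t t' ∧ q.r ≠ node y t t' := fun q hq t t' =>
    ⟨fun h => hy (labels_subset_of_mem_cuts hq _ (.inl (by simp [h, labels]))),
      fun h => hy (labels_subset_of_mem_cuts hq _ (.inr (by simp [h, labels])))⟩
  have hzl : ∀ q ∈ cuts y M W S, ∀ t t', q.l ≠ node z t t' ∧ q.r ≠ node z t t' := fun q hq t t' =>
    ⟨fun h => hz (labels_subset_of_mem_cuts hq _ (.inl (by simp [h, labels]))),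
      fun h => hz (labels_subset_of_mem_cuts hq _ (.inr (by simp [h, labels])))⟩
  have hU : {q ∈ cuts y M W ({y, z} + S) | q.IsGrown y z} =
      Cut.rightGrowLeft y z '' K ∪ Cut.rightGrowRight y z '' K' ∪
        (Cut.leftGrowLeft y z '' K ∪ Cut.leftGrowRight y z '' K) := by
    apply Set.Subset.antisymm
    · rintro ⟨c, x, l, r⟩ ⟨hq, ⟨t, ht⟩ | ⟨t, ht⟩ | ⟨t, ht⟩ | ⟨t, ht⟩⟩
      · obtain rfl : r = _ := ht
        exact .inl (.inl ⟨⟨c, x, l, t⟩, (rightGrowLeft_mem hy hz hyz h0 hWy hWz).1 hq, rfl⟩)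
      · obtain rfl : r = _ := ht
        exact .inl (.inr ⟨⟨c, x, l, t⟩, (rightGrowRight_mem hy hz hyz h0 hWy hWz).1 hq, rfl⟩)
      · obtain rfl : l = _ := ht
        exact .inr (.inl ⟨⟨c, x, t, r⟩, (leftGrowLeft_mem hy hz hyz h0 hWy hWz).1 hq, rfl⟩)
      · obtain rfl : l = _ := ht
        exact .inr (.inr ⟨⟨c, x, t, r⟩, (leftGrowRight_mem hy hz hyz h0 hWy hWz).1 hq, rfl⟩)
    · rintro _ ((⟨q, hq, rfl⟩ | ⟨q, hq, rfl⟩) | ⟨q, hq, rfl⟩ | ⟨q, hq, rfl⟩)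
      · exact ⟨(rightGrowLeft_mem hy hz hyz h0 hWy hWz).2 hq, .inl ⟨_, rfl⟩⟩
      · exact ⟨(rightGrowRight_mem hy hz hyz h0 hWy hWz).2 hq, .inr (.inl ⟨_, rfl⟩)⟩
      · exact ⟨(leftGrowLeft_mem hy hz hyz h0 hWy hWz).2 hq, .inr (.inr (.inl ⟨_, rfl⟩))⟩
      · exact ⟨(leftGrowRight_mem hy hz hyz h0 hWy hWz).2 hq, .inr (.inr (.inr ⟨_, rfl⟩))⟩
  rw [hU, Set.ncard_union_eq _ ((hK.image _).union (hK'.image _))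
      ((hK.image _).union (hK.image _)), Set.ncard_union_eq _ (hK.image _) (hK'.image _),
    Set.ncard_union_eq _ (hK.image _) (hK.image _),
    Set.ncard_image_of_injective _ Cut.rightGrowLeft_injective,
    Set.ncard_image_of_injective _ Cut.rightGrowRight_injective,
    Set.ncard_image_of_injective _ Cut.leftGrowLeft_injective,
    Set.ncard_image_of_injective _ Cut.leftGrowRight_injective]
  · ring
  · rw [Set.disjoint_left]
    rintro _ ⟨q, hq, rfl⟩ ⟨q', hq', h⟩
    simp only [Cut.leftGrowLeft, Cut.leftGrowRight, Cut.mk.injEq, node.injEq] at h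
    exact (hzl q' hq'.1 _ _).1 h.2.2.1.2.1
  · rw [Set.disjoint_left]
    rintro _ ⟨q, hq, rfl⟩ ⟨q', hq', h⟩
    simp only [Cut.rightGrowLeft, Cut.rightGrowRight, Cut.mk.injEq, node.injEq] at h
    exact (hzl q' hq'.1 _ _).2 h.2.2.2.2.1
  -- Growing on the right leaves the left subtree without the label `y`, while growing on the left
  -- puts `y` at its root.
  · rw [Set.disjoint_left]
    rintro _ (⟨q, hq, rfl⟩ | ⟨q, hq, rfl⟩) (⟨q', hq', h⟩ | ⟨q', hq', h⟩) <;>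
      exact (hyl q hq.1 _ _).1 (congrArg Cut.l h).symm

theorem ncard_pushed (hfin : (cuts y M W S).Finite) (hy : y ∉ S) (hz : z ∉ S) (hyz : y < z)
    (hyz' : (y' = y ∧ z' = z) ∨ (y' = z ∧ z' = y ∧ z = y + 1))
    (h0 : ¬ W nil) (hWy : Inherits W y) (hWz : Inherits W z) :
    {q ∈ cuts y M W ({y, z} + S) | q.IsPushed y' z'}.ncard =
      {q ∈ cuts y M W S | q.l ≠ nil}.ncard + 2 * {q ∈ cuts y M W S | q.l = nil}.ncard +
        {q ∈ cuts y M W S | q.l ≠ nil ∧ Odd q.r.numNodes}.ncard := by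
  have hU : {q ∈ cuts y M W ({y, z} + S) | q.IsPushed y' z'} =
      Cut.pushRight y' z' '' cuts y M W S ∪
        Cut.pushLeft y' z' '' {q ∈ cuts y M W S | q.l = nil ∨ Odd q.r.numNodes} := by
    apply Set.Subset.antisymm
    · rintro ⟨c, x, l, r⟩ ⟨hq, ⟨t, t', ht, ht'⟩ | ⟨t, t', ht, ht'⟩⟩
      · obtain rfl : l = _ := ht
        obtain rfl : r = _ := ht'
        exact .inl ⟨⟨c, x, t, t'⟩, (pushRight_mem hy hz hyz hyz' h0 hWy hWz).1 hq, rfl⟩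
      · obtain rfl : l = _ := ht
        obtain rfl : r = _ := ht'
        exact .inr ⟨⟨c, x, t, t'⟩, (pushLeft_mem hy hz hyz hyz' h0 hWy hWz).1 hq, rfl⟩
    · rintro _ (⟨q, hq, rfl⟩ | ⟨q, hq, rfl⟩)
      · exact ⟨(pushRight_mem hy hz hyz hyz' h0 hWy hWz).2 hq, .inl ⟨_, _, rfl, rfl⟩⟩
      · exact ⟨(pushLeft_mem hy hz hyz hyz' h0 hWy hWz).2 hq, .inr ⟨_, _, rfl, rfl⟩⟩
  have h1 : cuts y M W S = {q ∈ cuts y M W S | q.l ≠ nil} ∪ {q ∈ cuts y M W S | q.l = nil} := by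
    ext q
    by_cases h : q.l = nil <;> simp [h]
  have h2 : {q ∈ cuts y M W S | q.l = nil ∨ Odd q.r.numNodes} =
      {q ∈ cuts y M W S | q.l = nil} ∪ {q ∈ cuts y M W S | q.l ≠ nil ∧ Odd q.r.numNodes} := by
    ext q
    by_cases h : q.l = nil <;> simp +contextual [h]
  rw [hU, Set.ncard_union_eq _ (hfin.image _) ((hfin.subset fun _ h => h.1).image _),
    Set.ncard_image_of_injective _ Cut.pushRight_injective,
    Set.ncard_image_of_injective _ Cut.pushLeft_injective, h2,
    Set.ncard_union_eq _ (hfin.subset fun _ h => h.1) (hfin.subset fun _ h => h.1)]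
  · nth_rw 1 [h1]
    rw [Set.ncard_union_eq _ (hfin.subset fun _ h => h.1) (hfin.subset fun _ h => h.1)]
    · ring
    · rw [Set.disjoint_left]
      rintro q hq hq'
      exact hq.2 hq'.2
  · rw [Set.disjoint_left]
    rintro q hq hq'
    exact hq'.2.1 hq.2
  · rw [Set.disjoint_left]
    rintro _ ⟨q, hq, rfl⟩ ⟨q', hq', h⟩
    have := congrArg Cut.l h
    simp only [Cut.pushLeft, Cut.pushRight, node.injEq] at this
    omega

/-- The cuts with two odd subtrees cancel, which leaves a count depending only on whether the cut
node has a left child. Allowing `y'` and `z'` to be `y` and `z` in either order serves both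
differences. -/
theorem ncard_grown_add (hfin : (cuts y M W S).Finite) (hy : y ∉ S) (hz : z ∉ S) (hyz : y < z)
    (hyz' : (y' = y ∧ z' = z) ∨ (y' = z ∧ z' = y ∧ z = y + 1))
    (h0 : ¬ W nil) (hWy : Inherits W y) (hWz : Inherits W z) :
    ({q ∈ cuts y M W ({y, z} + S) | q.IsGrown y z}.ncard : ℤ) -
        {q ∈ cuts y M W ({y, z} + S) | q.IsPushed y' z'}.ncard =
      2 * (cuts y M W S).ncard - 4 * {q ∈ cuts y M W S | q.l = nil}.ncard := by
  rw [ncard_grown hfin hy hz hyz h0 hWy hWz, ncard_pushed hfin hy hz hyz hyz' h0 hWy hWz]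
  have h1 : cuts y M W S = {q ∈ cuts y M W S | q.l ≠ nil} ∪ {q ∈ cuts y M W S | q.l = nil} := by
    ext q
    by_cases h : q.l = nil <;> simp [h]
  have h2 : (cuts y M W S).ncard =
      {q ∈ cuts y M W S | q.l ≠ nil}.ncard + {q ∈ cuts y M W S | q.l = nil}.ncard := by
    nth_rw 1 [h1]
    refine Set.ncard_union_eq ?_ (hfin.subset fun _ h => h.1) (hfin.subset fun _ h => h.1)
    rw [Set.disjoint_left]
    rintro q hq hq'
    exact hq.2 hq'.2
  rw [h2]
  push_cast
  ring

end surgery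

/-! ### Relabelings -/

theorem labels_map (σ : ℕ → ℕ) (t : BinaryTree ℕ) : labels (t.map σ) = (labels t).map σ := by
  induction t with
  | nil => rfl
  | node a l r hl hr => simp [BinaryTree.map, labels, hl, hr]

theorem root?_map (σ : ℕ → ℕ) (t : BinaryTree ℕ) : root? (t.map σ) = (root? t).map σ := by
  cases t <;> rfl

theorem numNodes_map (σ : ℕ → ℕ) (t : BinaryTree ℕ) : (t.map σ).numNodes = t.numNodes := by
  rw [← card_labels, labels_map, Multiset.card_map, card_labels]

theorem map_eq_nil {σ : ℕ → ℕ} {t : BinaryTree ℕ} : t.map σ = nil ↔ t = nil := by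
  cases t <;> simp [BinaryTree.map]

theorem oddLeft_map {σ : ℕ → ℕ} {t : BinaryTree ℕ} : OddLeft (t.map σ) ↔ OddLeft t := by
  induction t with
  | nil => rfl
  | node a l r hl hr => simp only [BinaryTree.map, OddLeft, hl, hr, numNodes_map, map_eq_nil]

theorem isChild_map_iff (σ : Equiv.Perm ℕ) {a b : ℕ} {t : BinaryTree ℕ} :
    IsChild a b (t.map σ) ↔ IsChild (σ.symm a) (σ.symm b) t := by
  induction t with
  | nil => rfl
  | node x l r hl hr =>
    have h : ∀ t : BinaryTree ℕ, root? (t.map σ) = some b ↔ root? t = some (σ.symm b) := by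
      intro t
      rw [root?_map, Option.map_eq_some_iff]
      simp [← Equiv.eq_symm_apply]
    simp only [BinaryTree.map, IsChild, hl, hr, h, Equiv.eq_symm_apply]

theorem map_symm_map (σ : Equiv.Perm ℕ) (t : BinaryTree ℕ) : (t.map σ).map σ.symm = t := by
  rw [← comp_map, Equiv.symm_comp_self, id_map]

theorem map_map_symm (σ : Equiv.Perm ℕ) (t : BinaryTree ℕ) : (t.map σ.symm).map σ = t := by
  rw [← comp_map, Equiv.self_comp_symm, id_map]

theorem labelsIncrease_map (σ : Equiv.Perm ℕ) {t : BinaryTree ℕ}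
    (h : ∀ a b, IsChild a b t → σ a < σ b) : LabelsIncrease (t.map σ) := by
  rw [labelsIncrease_iff]
  intro a b hab
  simpa using h _ _ ((isChild_map_iff σ).1 hab)

/-- Two families of complete increasing trees that a relabeling exchanges have the same size. -/
theorem ncard_eq_of_relabel (σ : Equiv.Perm ℕ) {S S' : Finset ℕ} {P P' : BinaryTree ℕ → Prop}
    (hS : ∀ a, a ∈ S ↔ σ a ∈ S')
    (h : ∀ t, labels t = S.val → LabelsIncrease t → P t →
      LabelsIncrease (t.map σ) ∧ P' (t.map σ))
    (h' : ∀ t, labels t = S'.val → LabelsIncrease t → P' t →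
      LabelsIncrease (t.map σ.symm) ∧ P (t.map σ.symm)) :
    {t | Good S.val t ∧ P t}.ncard = {t | Good S'.val t ∧ P' t}.ncard := by
  have hS' : S.map σ.toEmbedding = S' := by
    ext a
    rw [Finset.mem_map_equiv, hS, Equiv.apply_symm_apply]
  have h1 : S.val.map σ = S'.val := by
    rw [← hS']
    rfl
  have h2 : S'.val.map σ.symm = S.val := by
    rw [← h1, Multiset.map_map, Equiv.symm_comp_self, Multiset.map_id]
  refine Set.ncard_congr (fun t _ => t.map σ) ?_ ?_ ?_
  · rintro t ⟨⟨ha, hb, hc⟩, hd⟩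
    obtain ⟨he, hf⟩ := h t ha hb hd
    exact ⟨⟨by rw [labels_map, ha, h1], he, oddLeft_map.2 hc⟩, hf⟩
  · intro t t' _ _ htt
    rw [← map_symm_map σ t, ← map_symm_map σ t']
    exact congrArg _ htt
  · rintro t ⟨⟨ha, hb, hc⟩, hd⟩
    obtain ⟨he, hf⟩ := h' t ha hb hd
    exact ⟨_, ⟨⟨by rw [labels_map, ha, h2], he, oddLeft_map.2 hc⟩, hf⟩, map_map_symm σ t⟩

/-- A relabeling that fixes the labels up to `m` does not change the property `eoc t = m`. -/
theorem eoc_map_of_fixed {σ : ℕ → ℕ} {m : ℕ} (h1 : ∀ b ≤ m, σ b = b) (h2 : ∀ b, m < b → m < σ b)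
    {t : BinaryTree ℕ} (hi : LabelsIncrease t) (ht : eoc t = m) : eoc (t.map σ) = m := by
  induction t with
  | nil => exact ht
  | node a l r hl hr =>
    obtain ⟨-, -, h3, h4⟩ := hi
    rcases minimal_child_cases l r with ⟨rfl, rfl⟩ | ⟨b, hb, h⟩ | ⟨b, hb, h⟩
    · exact (h1 a ht.le).trans ht
    · rw [eoc_of_lt hb h] at ht
      have hbm := h3.root_le_eoc hb
      rw [BinaryTree.map, eoc_of_lt (b := σ b) _ _, hl h3 ht]
      · rw [root?_map, hb, Option.map_some]
      · intro c hc
        rw [root?_map, Option.map_eq_some_iff] at hc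
        obtain ⟨c, hc, rfl⟩ := hc
        have := h c hc
        rw [h1 b (by omega)]
        rcases le_or_gt c m with hcm | hcm
        · rwa [h1 c hcm]
        · have := h2 c hcm
          omega
    · rw [eoc_of_le hb h] at ht
      have hbm := h4.root_le_eoc hb
      rw [BinaryTree.map, eoc_of_le (c := σ b) _ _, hr h4 ht]
      · rw [root?_map, hb, Option.map_some]
      · intro c hc
        rw [root?_map, Option.map_eq_some_iff] at hc
        obtain ⟨c, hc, rfl⟩ := hc
        have := h c hc
        rw [h1 b (by omega)]
        rcases le_or_gt c m with hcm | hcm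
        · rwa [h1 c hcm]
        · have := h2 c hcm
          omega

/-- An increasing relabeling. -/
theorem eoc_map_of_strictMonoOn {σ : ℕ → ℕ} {t : BinaryTree ℕ} (ht : t ≠ nil)
    (h : ∀ a ∈ labels t, ∀ b ∈ labels t, a < b → σ a < σ b) : eoc (t.map σ) = σ (eoc t) := by
  induction t with
  | nil => exact absurd rfl ht
  | node a l r hl hr =>
    simp only [labels, Multiset.mem_cons, Multiset.mem_add] at h
    rcases minimal_child_cases l r with ⟨rfl, rfl⟩ | ⟨b, hb, h'⟩ | ⟨b, hb, h'⟩
    · rfl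
    · rw [BinaryTree.map, eoc_of_lt hb h', eoc_of_lt (b := σ b) _ _, hl]
      · rintro rfl
        simp [root?] at hb
      · exact fun x hx y hy => h x (.inr (.inl hx)) y (.inr (.inl hy))
      · rw [root?_map, hb, Option.map_some]
      · intro c hc
        rw [root?_map, Option.map_eq_some_iff] at hc
        obtain ⟨c, hc, rfl⟩ := hc
        exact h _ (.inr (.inl (mem_labels_of_root? hb))) _ (.inr (.inr (mem_labels_of_root? hc)))
          (h' c hc)
    · rw [BinaryTree.map, eoc_of_le hb h', eoc_of_le (c := σ b) _ _, hr]
      · rintro rfl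
        simp [root?] at hb
      · exact fun x hx y hy => h x (.inr (.inr hx)) y (.inr (.inr hy))
      · rw [root?_map, hb, Option.map_some]
      · intro c hc
        rw [root?_map, Option.map_eq_some_iff] at hc
        obtain ⟨c, hc, rfl⟩ := hc
        rcases (h' c hc).eq_or_lt with rfl | hlt
        · exact le_rfl
        · exact (h _ (.inr (.inr (mem_labels_of_root? hb))) _
            (.inr (.inl (mem_labels_of_root? hc))) hlt).le

/-- The permutation that moves `i` to `j` and decreases by one the elements of `(i, j]`. -/
def moveUp (i j : ℕ) (h : i ≤ j) : Equiv.Perm ℕ where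
  toFun b := if b < i then b else if b = i then j else if b ≤ j then b - 1 else b
  invFun b := if b < i then b else if b = j then i else if b < j then b + 1 else b
  left_inv b := by dsimp only; split_ifs <;> omega
  right_inv b := by dsimp only; split_ifs <;> omega

theorem moveUp_apply {i j : ℕ} (h : i ≤ j) (b : ℕ) : moveUp i j h b =
    if b < i then b else if b = i then j else if b ≤ j then b - 1 else b := rfl

theorem moveUp_symm_apply {i j : ℕ} (h : i ≤ j) (b : ℕ) : (moveUp i j h).symm b =
    if b < i then b else if b = j then i else if b < j then b + 1 else b := rfl

/-! ### Children in a tree with distinct labels -/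

theorem isChild_fill_iff_of_mem {c : Ctx} {s : BinaryTree ℕ} {a b : ℕ}
    (hn : (labels (fill c s)).Nodup) (ha : a ∈ labels s) :
    IsChild a b (fill c s) ↔ IsChild a b s := by
  have hm : ∀ c, a ∈ labels (fill c s) := fun c => by simp [labels_fill, ha]
  induction c with
  | hole => rfl
  | left x c r ih =>
    simp only [fill, labels, Multiset.nodup_cons, Multiset.mem_add, Multiset.nodup_add] at hn
    replace ih := ih hn.2.1
    simp only [fill, IsChild]
    constructor
    · rintro (⟨rfl, -⟩ | h | h)
      · exact absurd (.inl (hm _)) hn.1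
      · exact ih.1 h
      · exact absurd h.mem.1 (Multiset.disjoint_left.1 hn.2.2.2 (hm _))
    · exact fun h => .inr (.inl (ih.2 h))
  | right x l c ih =>
    simp only [fill, labels, Multiset.nodup_cons, Multiset.mem_add, Multiset.nodup_add] at hn
    replace ih := ih hn.2.2.1
    simp only [fill, IsChild]
    constructor
    · rintro (⟨rfl, -⟩ | h | h)
      · exact absurd (.inr (hm _)) hn.1
      · exact absurd (hm _) (Multiset.disjoint_left.1 hn.2.2.2 h.mem.1)
      · exact ih.1 h
    · exact fun h => .inr (.inr (ih.2 h))

theorem isChild_fill_node_iff {c : Ctx} {l r : BinaryTree ℕ} {a b : ℕ}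
    (hn : (labels (fill c (node a l r))).Nodup) :
    IsChild a b (fill c (node a l r)) ↔ root? l = some b ∨ root? r = some b := by
  rw [isChild_fill_iff_of_mem hn (by simp [labels])]
  rw [labels_fill, Multiset.nodup_add] at hn
  have h1 := hn.2.1
  simp only [labels, Multiset.nodup_cons, Multiset.mem_add] at h1
  simp only [IsChild, true_and]
  constructor
  · rintro (h | h | h)
    · exact h
    · exact absurd (.inl h.mem.1) h1.1
    · exact absurd (.inr h.mem.1) h1.1
  · exact .inl

theorem isChild_fill_left_iff {c : Ctx} {l r r' : BinaryTree ℕ} {x a b : ℕ}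
    (hn : (labels (fill c (node x (node a l r) r'))).Nodup) :
    IsChild a b (fill c (node x (node a l r) r')) ↔ root? l = some b ∨ root? r = some b := by
  rw [isChild_fill_iff_of_mem hn (by simp [labels])]
  rw [labels_fill, Multiset.nodup_add] at hn
  exact isChild_fill_node_iff (c := .left x .hole r') hn.2.1

theorem isChild_fill_right_iff {c : Ctx} {l r l' : BinaryTree ℕ} {x a b : ℕ}
    (hn : (labels (fill c (node x l' (node a l r)))).Nodup) :
    IsChild a b (fill c (node x l' (node a l r))) ↔ root? l = some b ∨ root? r = some b := by
  rw [isChild_fill_iff_of_mem hn (by simp [labels])]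
  rw [labels_fill, Multiset.nodup_add] at hn
  exact isChild_fill_node_iff (c := .right x l' .hole) hn.2.1

theorem IsChild.parent_unique {t : BinaryTree ℕ} {a a' b : ℕ} (hn : (labels t).Nodup)
    (hi : LabelsIncrease t) (h : IsChild a b t) (h' : IsChild a' b t) : a = a' :=
  Option.some.inj (((parent?_eq_some hn hi).2 h).symm.trans ((parent?_eq_some hn hi).2 h'))

theorem eq_node_of_root? {t : BinaryTree ℕ} {a : ℕ} (h : root? t = some a) :
    ∃ l r, t = node a l r := by
  cases t with
  | nil => simp [root?] at h
  | node b l r =>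
    obtain rfl : b = a := by simpa [root?] using h
    exact ⟨l, r, rfl⟩

theorem LabelsIncrease.eq_leaf_of_le {t : BinaryTree ℕ} {a : ℕ} (hi : LabelsIncrease t)
    (ht : root? t = some a) (h : ∀ b ∈ labels t, b ≤ a) : t = node a nil nil := by
  obtain ⟨l, r, rfl⟩ := eq_node_of_root? ht
  have hl : root? l = none := Option.eq_none_iff_forall_ne_some.2 fun b hb =>
    absurd (hi.1 b hb) (h b (by simp [labels, mem_labels_of_root? hb])).not_gt
  have hr : root? r = none := Option.eq_none_iff_forall_ne_some.2 fun b hb =>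
    absurd (hi.2.1 b hb) (h b (by simp [labels, mem_labels_of_root? hb])).not_gt
  rw [root?_eq_none.1 hl, root?_eq_none.1 hr]

theorem LabelsIncrease.eq_leaf_of_eoc {t : BinaryTree ℕ} {a : ℕ} (hi : LabelsIncrease t)
    (ht : root? t = some a) (h : eoc t = a) : t = node a nil nil := by
  obtain ⟨l, r, rfl⟩ := eq_node_of_root? ht
  rcases minimal_child_cases l r with ⟨rfl, rfl⟩ | ⟨b, hb, h'⟩ | ⟨b, hb, h'⟩
  · rfl
  · rw [eoc_of_lt hb h'] at h
    exact absurd (hi.1 b hb) (h ▸ hi.2.2.1.root_le_eoc hb).not_gt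
  · rw [eoc_of_le hb h'] at h
    exact absurd (hi.2.1 b hb) (h ▸ hi.2.2.2.root_le_eoc hb).not_gt

theorem ncard_and_add_ncard_and_not {P Q : BinaryTree ℕ → Prop} (h : {t | P t}.Finite) :
    {t | P t ∧ Q t}.ncard + {t | P t ∧ ¬ Q t}.ncard = {t | P t}.ncard := by
  rw [← Set.ncard_union_eq _ (h.subset fun _ h => h.1) (h.subset fun _ h => h.1)]
  · congr 1
    ext t
    by_cases hQ : Q t <;> simp [hQ]
  · rw [Set.disjoint_left]
    exact fun t ht ht' => ht'.2 ht.2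

theorem val_eq_pair_add_sdiff {F : Finset ℕ} {y z : ℕ} (hy : y ∈ F) (hz : z ∈ F) (hyz : y ≠ z) :
    F.val = {y, z} + (F \ {y, z}).val := by
  have h : F = insert y (insert z (F \ {y, z})) := by
    ext a
    simp only [Finset.mem_insert, Finset.mem_sdiff, Finset.mem_singleton]
    constructor
    · tauto
    · rintro (rfl | rfl | h)
      exacts [hy, hz, h.1]
  nth_rw 1 [h]
  rw [Finset.insert_val_of_notMem (by simp [hyz]), Finset.insert_val_of_notMem (by simp)]
  simp

/-! ### The difference with respect to the parent of the maximum leaf -/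

/-- The cuts at the node `k` of the complete increasing trees on `S` whose minimal chain ends
at `m`. -/
def labelCuts (m k : ℕ) (S : Multiset ℕ) : Set Cut :=
  cuts (k + 1) (fun c x _ => x = k ∧ eoc (fill c (node k nil nil)) = m) (fun _ => False) S

section labelCuts

variable {m k : ℕ} {S : Multiset ℕ}

/-- Since `m < k`, a chain entering the subtree at `k` cannot end at `m`; the condition on `eoc`
therefore depends on the context alone. -/
theorem mem_labelCuts_iff (hmk : m < k) {q : Cut} :
    q ∈ labelCuts m k S ↔ Good S q.toTree ∧ q.x = k ∧ eoc q.toTree = m := by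
  have key : ∀ c l r, LabelsIncrease (fill c (node k l r)) →
      (eoc (fill c (node k nil nil)) = m ↔ eoc (fill c (node k l r)) = m) := fun c l r h =>
    eoc_fill_eq_iff rfl rfl hmk.ne' (hmk.trans_le (h.of_fill.root_le_eoc rfl)).ne'
  obtain ⟨c, x, l, r⟩ := q
  constructor
  · rintro ⟨h1, ⟨rfl, h2⟩, -⟩
    exact ⟨h1, rfl, (key c l r h1.2.1).1 h2⟩
  · rintro ⟨h1, rfl, h2⟩
    have h3 : LabelsIncrease (node x l r) := h1.2.1.of_fill
    exact ⟨h1, ⟨rfl, (key c l r h1.2.1).2 h2⟩, Nat.lt_succ_self _, h3.1, h3.2.1⟩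

theorem injOn_toTree_labelCuts (hS : S.Nodup) (hmk : m < k) :
    Set.InjOn Cut.toTree (labelCuts m k S) := by
  intro q hq q' hq' h
  rw [mem_labelCuts_iff hmk] at hq hq'
  obtain ⟨c, x, l, r⟩ := q
  obtain ⟨c', x', l', r'⟩ := q'
  obtain rfl : x = k := hq.2.1
  obtain rfl : x' = x := hq'.2.1
  obtain ⟨rfl, rfl, rfl⟩ := fill_node_inj h (hq.1.1 ▸ hS)
  rfl

theorem finite_labelCuts (hS : S.Nodup) (hmk : m < k) : (labelCuts m k S).Finite :=
  Set.Finite.of_finite_image ((finite_good S).subset (by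
    rintro _ ⟨q, hq, rfl⟩
    exact hq.1)) (injOn_toTree_labelCuts hS hmk)

theorem ncard_eq_ncard_labelCuts (hS : S.Nodup) (hmk : m < k) (hk : k ∈ S)
    {P : BinaryTree ℕ → Prop} {P' : Cut → Prop}
    (h : ∀ q ∈ labelCuts m k S, P q.toTree ↔ P' q) :
    {t | Good S t ∧ eoc t = m ∧ P t}.ncard = {q ∈ labelCuts m k S | P' q}.ncard := by
  rw [← ((injOn_toTree_labelCuts hS hmk).mono fun q hq => hq.1).ncard_image]
  congr 1
  apply Set.Subset.antisymm
  · rintro t ⟨h1, h2, h3⟩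
    obtain ⟨c, l, r, rfl⟩ := exists_fill_of_mem (x := k) (h1.1.symm ▸ hk)
    have hq : (⟨c, k, l, r⟩ : Cut) ∈ labelCuts m k S := (mem_labelCuts_iff hmk).2 ⟨h1, rfl, h2⟩
    exact ⟨_, ⟨hq, (h _ hq).1 h3⟩, rfl⟩
  · rintro _ ⟨q, ⟨hq, hq'⟩, rfl⟩
    have h1 := (mem_labelCuts_iff hmk).1 hq
    exact ⟨h1.1, h1.2.2, (h q hq).2 hq'⟩

/-- The node with the maximum label `N` is necessarily a leaf. -/
theorem isGrown_iff_of_mem_labelCuts {N : ℕ} (hmk : m < k) {q : Cut}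
    (hq : q ∈ labelCuts m k (Finset.Icc 1 N).val) :
    IsChild (k + 1) N q.toTree ∧ IsChild k (k + 1) q.toTree ↔ q.IsGrown (k + 1) N := by
  obtain ⟨c, x, l, r⟩ := q
  obtain ⟨h1, rfl, h2⟩ := (mem_labelCuts_iff hmk).1 hq
  dsimp only at hmk
  have hn : (labels (fill c (node x l r))).Nodup := by
    rw [show labels (fill c (node x l r)) = _ from h1.1]
    exact Finset.nodup _
  have hle : ∀ b ∈ labels (node x l r), b ≤ N := fun b hb => by
    have : b ∈ (Finset.Icc 1 N).val := by
      rw [← h1.1, Cut.toTree, labels_fill]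
      exact Multiset.mem_add.2 (.inr hb)
    exact (Finset.mem_Icc.1 this).2
  have hleaf : ∀ t, LabelsIncrease t → (∀ b ∈ labels t, b ∈ labels (node x l r)) →
      root? t = some N → t = node N nil nil := fun t hi ht h =>
    hi.eq_leaf_of_le h fun b hb => hle b (ht b hb)
  have hi : LabelsIncrease (node x l r) := h1.2.1.of_fill
  simp only [Cut.toTree, Cut.IsGrown, isChild_fill_node_iff hn]
  constructor
  · rintro ⟨h3, h4 | h4⟩
    · obtain ⟨u, v, rfl⟩ := eq_node_of_root? h4
      rw [isChild_fill_left_iff hn] at h3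
      rcases h3 with h3 | h3
      · refine .inr (.inr (.inl ⟨v, ?_⟩))
        rw [hleaf u hi.2.2.1.2.2.1 (by simp +contextual [labels]) h3]
      · refine .inr (.inr (.inr ⟨u, ?_⟩))
        rw [hleaf v hi.2.2.1.2.2.2 (by simp +contextual [labels]) h3]
    · obtain ⟨u, v, rfl⟩ := eq_node_of_root? h4
      rw [isChild_fill_right_iff hn] at h3
      rcases h3 with h3 | h3
      · refine .inl ⟨v, ?_⟩
        rw [hleaf u hi.2.2.2.2.2.1 (by simp +contextual [labels]) h3]
      · refine .inr (.inl ⟨u, ?_⟩)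
        rw [hleaf v hi.2.2.2.2.2.2 (by simp +contextual [labels]) h3]
  · rintro (⟨t, rfl⟩ | ⟨t, rfl⟩ | ⟨t, rfl⟩ | ⟨t, rfl⟩)
    · exact ⟨(isChild_fill_right_iff hn).2 (.inl rfl), .inr rfl⟩
    · exact ⟨(isChild_fill_right_iff hn).2 (.inr rfl), .inr rfl⟩
    · exact ⟨(isChild_fill_left_iff hn).2 (.inl rfl), .inl rfl⟩
    · exact ⟨(isChild_fill_left_iff hn).2 (.inr rfl), .inl rfl⟩

theorem isPushed_iff_of_mem_labelCuts {N : ℕ} (hmk : m < k) (hkN : k + 1 < N) {q : Cut}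
    (hq : q ∈ labelCuts m k (Finset.Icc 1 N).val) :
    IsChild k N q.toTree ∧ IsChild k (k + 1) q.toTree ↔ q.IsPushed (k + 1) N := by
  obtain ⟨c, x, l, r⟩ := q
  obtain ⟨h1, rfl, h2⟩ := (mem_labelCuts_iff hmk).1 hq
  dsimp only at hmk hkN
  have hn : (labels (fill c (node x l r))).Nodup := by
    rw [show labels (fill c (node x l r)) = _ from h1.1]
    exact Finset.nodup _
  have hle : ∀ b ∈ labels (node x l r), b ≤ N := fun b hb => by
    have : b ∈ (Finset.Icc 1 N).val := by
      rw [← h1.1, Cut.toTree, labels_fill]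
      exact Multiset.mem_add.2 (.inr hb)
    exact (Finset.mem_Icc.1 this).2
  have hi : LabelsIncrease (node x l r) := h1.2.1.of_fill
  simp only [Cut.toTree, Cut.IsPushed, isChild_fill_node_iff hn]
  constructor
  · rintro ⟨h3 | h3, h4 | h4⟩
    · rw [h3, Option.some.injEq] at h4
      omega
    · obtain ⟨u, v, rfl⟩ := eq_node_of_root? h4
      exact .inl ⟨u, v, hi.2.2.1.eq_leaf_of_le h3 fun b hb => hle b (by simp [labels, hb]), rfl⟩
    · obtain ⟨u, v, rfl⟩ := eq_node_of_root? h4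
      exact .inr ⟨u, v, rfl, hi.2.2.2.eq_leaf_of_le h3 fun b hb => hle b (by simp [labels, hb])⟩
    · rw [h3, Option.some.injEq] at h4
      omega
  · rintro (⟨u, v, rfl, rfl⟩ | ⟨u, v, rfl, rfl⟩)
    · exact ⟨.inl rfl, .inr rfl⟩
    · exact ⟨.inr rfl, .inl rfl⟩

/-- By `OddLeft`, a node without left child has no right child either. -/
theorem left_eq_nil_iff_of_mem_labelCuts (hS : S.Nodup) (hmk : m < k) {q : Cut}
    (hq : q ∈ labelCuts m k S) :
    (∀ b, ¬ IsChild k b q.toTree) ↔ q.l = nil := by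
  obtain ⟨c, x, l, r⟩ := q
  obtain ⟨h1, rfl, h2⟩ := (mem_labelCuts_iff hmk).1 hq
  have hn : (labels (fill c (node x l r))).Nodup := h1.1 ▸ hS
  have ho : OddLeft (node x l r) := h1.2.2.of_fill
  simp only [Cut.toTree, isChild_fill_node_iff hn, not_or]
  constructor
  · exact fun h => root?_eq_none.1 (Option.eq_none_iff_forall_ne_some.2 fun b => (h b).1)
  · rintro rfl
    obtain h | ⟨-, rfl⟩ := ho.1
    · simp at h
    · simp [root?]

end labelCuts

/-! ### Relabelings behind the difference in `k` -/

/-- Exchanging the labels `k` and `k + 1` when they are not adjacent. -/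
theorem labelsIncrease_swap {k : ℕ} {t : BinaryTree ℕ} (hi : LabelsIncrease t)
    (h : ¬ IsChild k (k + 1) t) : LabelsIncrease (t.map (Equiv.swap k (k + 1))) := by
  refine labelsIncrease_map _ fun a b hab => ?_
  have h1 := labelsIncrease_iff.1 hi a b hab
  have h2 : ¬ (a = k ∧ b = k + 1) := by
    rintro ⟨rfl, rfl⟩
    exact h hab
  simp only [Equiv.swap_apply_def]
  split_ifs <;> omega

theorem not_isChild_swap {k : ℕ} {t : BinaryTree ℕ} (hi : LabelsIncrease t) :
    ¬ IsChild k (k + 1) (t.map (Equiv.swap k (k + 1))) := by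
  rw [isChild_map_iff, Equiv.symm_swap, Equiv.swap_apply_left, Equiv.swap_apply_right]
  intro h
  have := labelsIncrease_iff.1 hi _ _ h
  omega

theorem eoc_swap_of_lt {m k : ℕ} (hmk : m < k) {t : BinaryTree ℕ} (hi : LabelsIncrease t)
    (ht : eoc t = m) : eoc (t.map (Equiv.swap k (k + 1))) = m := by
  refine eoc_map_of_fixed (fun b hb => ?_) (fun b hb => ?_) hi ht
  · exact Equiv.swap_apply_of_ne_of_ne (by omega) (by omega)
  · rw [Equiv.swap_apply_def]
    split_ifs <;> omega

theorem swap_mem_Icc_iff {k N a : ℕ} (hk : 1 ≤ k) (hkN : k + 1 ≤ N) :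
    a ∈ Finset.Icc 1 N ↔ Equiv.swap k (k + 1) a ∈ Finset.Icc 1 N := by
  rw [Equiv.swap_apply_def, Finset.mem_Icc, Finset.mem_Icc]
  split_ifs <;> omega

theorem ncard_swap_parent {m k N : ℕ} (hmk : m < k) (hkN : k + 1 < N) :
    {t | Good (Finset.Icc 1 N).val t ∧ ((eoc t = m ∧ IsChild k N t) ∧ ¬ IsChild k (k + 1) t)}.ncard =
    {t | Good (Finset.Icc 1 N).val t ∧
      ((eoc t = m ∧ IsChild (k + 1) N t) ∧ ¬ IsChild k (k + 1) t)}.ncard := by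
  have hN : Equiv.swap k (k + 1) N = N := Equiv.swap_apply_of_ne_of_ne (by omega) (by omega)
  refine ncard_eq_of_relabel (Equiv.swap k (k + 1))
    (fun a => swap_mem_Icc_iff (by omega) (by omega)) ?_ ?_
  · rintro t - hi ⟨⟨h1, h2⟩, h3⟩
    refine ⟨labelsIncrease_swap hi h3, ⟨eoc_swap_of_lt hmk hi h1, ?_⟩, not_isChild_swap hi⟩
    rwa [isChild_map_iff, Equiv.symm_swap, Equiv.swap_apply_right, hN]
  · rintro t - hi ⟨⟨h1, h2⟩, h3⟩
    rw [Equiv.symm_swap]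
    refine ⟨labelsIncrease_swap hi h3, ⟨eoc_swap_of_lt hmk hi h1, ?_⟩, not_isChild_swap hi⟩
    rwa [isChild_map_iff, Equiv.symm_swap, Equiv.swap_apply_left, hN]

/-- If `k` is a leaf, then `k + 1` is not its child and the exchange is admissible; only the other
side needs this excluded explicitly. -/
theorem ncard_swap_leaf {m k N : ℕ} (hmk : m < k) (hkN : k + 1 ≤ N) :
    {t | Good (Finset.Icc 1 N).val t ∧ (eoc t = m ∧ ∀ b, ¬ IsChild k b t)}.ncard =
    {t | Good (Finset.Icc 1 N).val t ∧
      ((eoc t = m ∧ ∀ b, ¬ IsChild (k + 1) b t) ∧ ¬ IsChild k (k + 1) t)}.ncard := by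
  refine ncard_eq_of_relabel (Equiv.swap k (k + 1))
    (fun a => swap_mem_Icc_iff (by omega) (by omega)) ?_ ?_
  · rintro t - hi ⟨h1, h2⟩
    refine ⟨labelsIncrease_swap hi (h2 _), ⟨eoc_swap_of_lt hmk hi h1, fun b => ?_⟩,
      not_isChild_swap hi⟩
    rw [isChild_map_iff, Equiv.symm_swap, Equiv.swap_apply_right]
    exact h2 _
  · rintro t - hi ⟨⟨h1, h2⟩, h3⟩
    rw [Equiv.symm_swap]
    refine ⟨labelsIncrease_swap hi h3, eoc_swap_of_lt hmk hi h1, fun b => ?_⟩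
    rw [isChild_map_iff, Equiv.symm_swap, Equiv.swap_apply_left]
    exact h2 _

/-- A leaf `k + 1` whose parent is `k` can be made the maximum leaf. -/
theorem ncard_leaf_to_max {m k N : ℕ} (hmk : m < k) (hkN : k + 1 ≤ N) :
    {t | Good (Finset.Icc 1 N).val t ∧
      ((eoc t = m ∧ ∀ b, ¬ IsChild (k + 1) b t) ∧ IsChild k (k + 1) t)}.ncard =
    {t | Good (Finset.Icc 1 N).val t ∧ (eoc t = m ∧ IsChild k N t)}.ncard := by
  refine ncard_eq_of_relabel (moveUp (k + 1) N hkN) (fun a => ?_) ?_ ?_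
  · rw [moveUp_apply, Finset.mem_Icc, Finset.mem_Icc]
    split_ifs <;> omega
  · rintro t ht hi ⟨⟨h1, h2⟩, h3⟩
    refine ⟨labelsIncrease_map _ fun a b hab => ?_,
      eoc_map_of_fixed (fun b hb => ?_) (fun b hb => ?_) hi h1, ?_⟩
    · have h4 := labelsIncrease_iff.1 hi a b hab
      have h5 : a ≠ k + 1 := fun h => h2 b (h ▸ hab)
      have h6 : b = k + 1 → a = k := fun h =>
        (h ▸ hab).parent_unique (by rw [ht]; exact Finset.nodup _) hi h3
      simp only [moveUp_apply]
      split_ifs <;> omega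
    · rw [moveUp_apply, if_pos (by omega)]
    · rw [moveUp_apply]
      split_ifs <;> omega
    · rw [isChild_map_iff, moveUp_symm_apply, moveUp_symm_apply, if_pos (by omega),
        if_neg (by omega), if_pos rfl]
      exact h3
  · rintro t ht hi ⟨h1, h2⟩
    have hN : ∀ a b, IsChild a b t → b ≤ N := fun a b hab => by
      have := ht ▸ hab.mem.2
      exact (Finset.mem_Icc.1 this).2
    refine ⟨labelsIncrease_map _ fun a b hab => ?_,
      ⟨eoc_map_of_fixed (fun b hb => ?_) (fun b hb => ?_) hi h1, fun b => ?_⟩, ?_⟩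
    · have h4 := labelsIncrease_iff.1 hi a b hab
      have h5 := hN a b hab
      -- The label `N` drops to `k + 1`, so its parent must stay below `k + 1`; it does, being `k`.
      have h6 : b = N → a = k := fun h =>
        (h ▸ hab).parent_unique (by rw [ht]; exact Finset.nodup _) hi h2
      simp only [moveUp_symm_apply]
      split_ifs <;> omega
    · rw [moveUp_symm_apply, if_pos (by omega)]
    · rw [moveUp_symm_apply]
      split_ifs <;> omega
    · rw [isChild_map_iff, Equiv.symm_symm, moveUp_apply, if_neg (by omega), if_pos rfl]
      intro h
      have h3 := labelsIncrease_iff.1 hi _ _ h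
      have h4 := hN _ _ h
      omega
    · rw [isChild_map_iff, Equiv.symm_symm, moveUp_apply, moveUp_apply, if_pos (by omega),
        if_neg (by omega), if_pos rfl]
      exact h2

/-- Relabeling after the removal of `k + 1` and of the maximum. -/
theorem ncard_remove_succ_max {m k N : ℕ} (hmk : m < k) (hkN : k + 1 < N) (p : Prop) :
    {t | Good (Finset.Icc 1 N \ {k + 1, N}).val t ∧
      (eoc t = m ∧ (p → ∀ b, ¬ IsChild k b t))}.ncard =
    {t | Good (Finset.Icc 1 (N - 2)).val t ∧ (eoc t = m ∧ (p → ∀ b, ¬ IsChild k b t))}.ncard := by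
  refine ncard_eq_of_relabel (moveUp (k + 1) (N - 1) (by omega)) (fun a => ?_) ?_ ?_
  · rw [moveUp_apply, Finset.mem_sdiff, Finset.mem_Icc, Finset.mem_Icc, Finset.mem_insert,
      Finset.mem_singleton]
    split_ifs <;> omega
  · rintro t ht hi ⟨h1, h2⟩
    refine ⟨labelsIncrease_map _ fun a b hab => ?_,
      eoc_map_of_fixed (fun b hb => ?_) (fun b hb => ?_) hi h1, fun hp b => ?_⟩
    · have h4 := labelsIncrease_iff.1 hi a b hab
      have h5 := ht ▸ hab.mem.1
      have h6 := ht ▸ hab.mem.2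
      simp only [Finset.mem_val, Finset.mem_sdiff, Finset.mem_Icc, Finset.mem_insert,
        Finset.mem_singleton] at h5 h6
      simp only [moveUp_apply]
      split_ifs <;> omega
    · rw [moveUp_apply, if_pos (by omega)]
    · rw [moveUp_apply]
      split_ifs <;> omega
    · rw [isChild_map_iff, moveUp_symm_apply, if_pos (by omega)]
      exact h2 hp _
  · rintro t ht hi ⟨h1, h2⟩
    refine ⟨labelsIncrease_map _ fun a b hab => ?_,
      eoc_map_of_fixed (fun b hb => ?_) (fun b hb => ?_) hi h1, fun hp b => ?_⟩
    · have h4 := labelsIncrease_iff.1 hi a b hab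
      have h5 := ht ▸ hab.mem.1
      have h6 := ht ▸ hab.mem.2
      simp only [Finset.mem_val, Finset.mem_Icc] at h5 h6
      simp only [moveUp_symm_apply]
      split_ifs <;> omega
    · rw [moveUp_symm_apply, if_pos (by omega)]
    · rw [moveUp_symm_apply]
      split_ifs <;> omega
    · rw [isChild_map_iff, Equiv.symm_symm, moveUp_apply, if_pos (by omega)]
      exact h2 hp _

theorem diffK_f_eq {m k N : ℕ} (hmk : m < k) (hkN : k + 1 < N) :
    diffK (f N) m k = 2 * {t | Good (Finset.Icc 1 (N - 2)).val t ∧ eoc t = m}.ncard -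
      4 * {t | Good (Finset.Icc 1 (N - 2)).val t ∧ (eoc t = m ∧ ∀ b, ¬ IsChild k b t)}.ncard := by
  have hk : k + 1 ∈ Finset.Icc 1 N := Finset.mem_Icc.2 (by omega)
  have hN : N ∈ Finset.Icc 1 N := Finset.mem_Icc.2 (by omega)
  have hval := val_eq_pair_add_sdiff hk hN hkN.ne
  set S := (Finset.Icc 1 N \ {k + 1, N}).val with hS
  have hSn : S.Nodup := Finset.nodup _
  have hIn : (Finset.Icc 1 N).val.Nodup := Finset.nodup _
  have hkS : k ∈ S := by
    simp only [hS, Finset.mem_val, Finset.mem_sdiff, Finset.mem_Icc, Finset.mem_insert,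
      Finset.mem_singleton]
    omega
  have hyS : k + 1 ∉ S := by
    rw [hS, Finset.mem_val, Finset.mem_sdiff, Finset.mem_insert]
    tauto
  have hzS : N ∉ S := by
    rw [hS, Finset.mem_val, Finset.mem_sdiff, Finset.mem_insert, Finset.mem_singleton]
    tauto
  have hkI : k ∈ (Finset.Icc 1 N).val := by
    rw [Finset.mem_val, Finset.mem_Icc]
    omega
  have e1 := ncard_and_add_ncard_and_not (P := fun t => Good (Finset.Icc 1 N).val t ∧
    (eoc t = m ∧ IsChild (k + 1) N t)) (Q := IsChild k (k + 1))
    ((finite_good _).subset fun _ h => h.1)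
  have e2 := ncard_and_add_ncard_and_not (P := fun t => Good (Finset.Icc 1 N).val t ∧
    (eoc t = m ∧ IsChild k N t)) (Q := IsChild k (k + 1))
    ((finite_good _).subset fun _ h => h.1)
  simp only [and_assoc] at e1 e2
  have e3 := ncard_swap_parent hmk hkN
  simp only [and_assoc] at e3
  have e4 := ncard_eq_ncard_labelCuts hIn hmk hkI
    (P := fun t => IsChild (k + 1) N t ∧ IsChild k (k + 1) t)
    (fun q hq => isGrown_iff_of_mem_labelCuts hmk hq)
  have e5 := ncard_eq_ncard_labelCuts hIn hmk hkI
    (P := fun t => IsChild k N t ∧ IsChild k (k + 1) t)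
    (fun q hq => isPushed_iff_of_mem_labelCuts hmk hkN hq)
  -- The premises `False` and `True` count all cuts and those at a leaf `k`, in the shape required
  -- by `ncard_remove_succ_max`.
  have e6 := ncard_eq_ncard_labelCuts hSn hmk hkS (P := fun t => False → ∀ b, ¬ IsChild k b t)
    (P' := fun _ => True) (fun q hq => by simp)
  have e7 := ncard_eq_ncard_labelCuts hSn hmk hkS
    (P := fun t => True → ∀ b, ¬ IsChild k b t) (P' := fun q => q.l = nil)
    (fun q hq => by rw [true_implies]; exact left_eq_nil_iff_of_mem_labelCuts hSn hmk hq)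
  have e8 := ncard_grown_add (finite_labelCuts hSn hmk) (y := k + 1) (z := N) hyS hzS hkN
    (.inl ⟨rfl, rfl⟩) (by simp) (by simp [Inherits]) (by simp [Inherits])
  rw [← hval] at e8
  rw [hS, ncard_remove_succ_max hmk hkN] at e6 e7
  rw [← hS] at e6 e7
  simp only [false_implies, true_implies, and_true, Set.ofPred_mem_eq] at e6 e7
  rw [e6, e7, diffK, f_eq (by omega) (by omega), f_eq (by omega) (by omega), ← e1, ← e2, ← e3, e4,
    e5]
  push_cast
  unfold labelCuts
  linear_combination e8

/-- The term of `diffK_f_eq` without the leaf condition does not involve `k` and drops out. Of the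
trees with a leaf `k + 1`, those where it is not a child of `k` match the trees with a leaf `k`. -/
theorem diffK_diffK_f {m k N : ℕ} (hmk : m < k) (hkN : k + 3 ≤ N) :
    diffK (diffK (f N)) m k + 4 * f (N - 2) m k = 0 := by
  have e1 := ncard_and_add_ncard_and_not (P := fun t => Good (Finset.Icc 1 (N - 2)).val t ∧
    (eoc t = m ∧ ∀ b, ¬ IsChild (k + 1) b t)) (Q := IsChild k (k + 1))
    ((finite_good _).subset fun _ h => h.1)
  have e2 := ncard_swap_leaf hmk (N := N - 2) (by omega)
  have e3 := ncard_leaf_to_max hmk (N := N - 2) (by omega)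
  simp only [and_assoc] at e1 e2 e3
  rw [diffK, diffK_f_eq (by omega) (by omega), diffK_f_eq (by omega) (by omega), ← e1, ← e2, e3,
    f_eq (by omega) (by omega)]
  push_cast
  ring

/-! ### The difference with respect to the end of the minimal chain -/

/-- The cuts of the complete increasing trees on `S` at the last node of the minimal chain with a
label less than `m`, where `N` is a child of `k`. -/
def chainCuts (m k N : ℕ) (S : Multiset ℕ) : Set Cut :=
  cuts m (fun c x w => c.OnChain x ∧ (IsChild k N (fill c (node x nil nil)) ∨ w)) (IsChild k N) S

section chainCuts

variable {m k N : ℕ} {S : Multiset ℕ}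

/-- As `q.x < m ≤ k`, the parent of `N` is not the cut node: it lies in the context or in one
subtree, and surgery preserves which tree edges join `k` to `N`. -/
theorem mem_chainCuts_iff (hmk : m ≤ k) {q : Cut} :
    q ∈ chainCuts m k N S ↔ Good S q.toTree ∧ IsChild k N q.toTree ∧ q.ctx.OnChain q.x ∧ q.x < m ∧
      (∀ b, root? q.l = some b → m ≤ b) ∧ ∀ b, root? q.r = some b → m ≤ b := by
  have key : q.x < m → (IsChild k N q.toTree ↔ IsChild k N (fill q.ctx (node q.x nil nil)) ∨
      IsChild k N q.l ∨ IsChild k N q.r) := fun h => by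
    rw [Cut.toTree, isChild_fill_iff (p := q.x) rfl]
    simp [IsChild, (h.trans_le hmk).ne]
  constructor
  · rintro ⟨h1, ⟨h2, h3⟩, h4, h5⟩
    exact ⟨h1, (key h4).2 h3, h2, h4, h5⟩
  · rintro ⟨h1, h2, h3, h4, h5⟩
    exact ⟨h1, ⟨h3, (key h4).1 h2⟩, h4, h5⟩

theorem injOn_toTree_chainCuts (hmk : m ≤ k) : Set.InjOn Cut.toTree (chainCuts m k N S) := by
  intro q hq q' hq' h
  rw [mem_chainCuts_iff hmk] at hq hq'
  obtain ⟨h1, -, h3, h4, h5, h6⟩ := hq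
  obtain ⟨h1', -, h3', h4', h5', h6'⟩ := hq'
  obtain ⟨ha, hb, hc, hd⟩ := fill_onChain_inj h h1.2.1 h3 h3' h4 h4' h5 h6 h5' h6'
  exact Cut.ext ha hb hc hd

theorem finite_chainCuts (hmk : m ≤ k) : (chainCuts m k N S).Finite :=
  Set.Finite.of_finite_image ((finite_good S).subset (by
    rintro _ ⟨q, hq, rfl⟩
    exact hq.1)) (injOn_toTree_chainCuts hmk)

theorem ncard_eq_ncard_chainCuts (hmk : m ≤ k) {a : ℕ} (ha : a ∈ S) (ham : a < m)
    {P : BinaryTree ℕ → Prop} {P' : Cut → Prop}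
    (h : ∀ q ∈ chainCuts m k N S, P q.toTree ↔ P' q) :
    {t | Good S t ∧ IsChild k N t ∧ P t}.ncard = {q ∈ chainCuts m k N S | P' q}.ncard := by
  rw [← ((injOn_toTree_chainCuts hmk).mono fun q hq => hq.1).ncard_image]
  congr 1
  apply Set.Subset.antisymm
  · rintro t ⟨h1, h2, h3⟩
    have hat : a ∈ labels t := h1.1.symm ▸ ha
    obtain ⟨b, hb⟩ : ∃ b, root? t = some b := by
      cases t with
      | nil => simp [labels] at hat
      | node b l r => exact ⟨b, rfl⟩
    obtain ⟨c, p, l, r, rfl, h4⟩ := exists_fill_onChain hb ((h1.2.1.root_le hb hat).trans_lt ham)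
    have hq : (⟨c, p, l, r⟩ : Cut) ∈ chainCuts m k N S := (mem_chainCuts_iff hmk).2 ⟨h1, h2, h4⟩
    exact ⟨_, ⟨hq, (h _ hq).1 h3⟩, rfl⟩
  · rintro _ ⟨q, ⟨hq, hq'⟩, rfl⟩
    have h1 := (mem_chainCuts_iff hmk).1 hq
    exact ⟨h1.1, h1.2.1, (h q hq).2 hq'⟩

/-- The chain node after the cut has label `m` or `m + 1`. It is not `m + 1`, whose parent is `m`;
so it is `m`, and the chain ends one step later. -/
theorem isGrown_iff_of_mem_chainCuts (hS : S.Nodup) (hmk : m ≤ k) {q : Cut}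
    (hq : q ∈ chainCuts m k N S) :
    eoc q.toTree = m + 1 ∧ IsChild m (m + 1) q.toTree ↔ q.IsGrown m (m + 1) := by
  obtain ⟨c, x, l, r⟩ := q
  obtain ⟨h1, -, h2, h3, h4, h5⟩ := (mem_chainCuts_iff hmk).1 hq
  dsimp only at h2 h3 h4 h5
  have hn : (labels (fill c (node x l r))).Nodup := h1.1 ▸ hS
  have hn' : (labels (node x l r)).Nodup := by
    rw [labels_fill, Multiset.nodup_add] at hn
    exact hn.2.1
  have hi : LabelsIncrease (node x l r) := h1.2.1.of_fill
  simp only [Cut.toTree, Cut.IsGrown, eoc_fill (s := node x l r) rfl h2]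
  simp only [labels, Multiset.nodup_cons, Multiset.nodup_add] at hn'
  have hlr : ∀ y, y ∈ labels l → y ∈ labels r → False := fun y hy hy' =>
    Multiset.disjoint_left.1 hn'.2.2.2 hy hy'
  -- the child `m` has a leaf `m + 1` as a child
  have aux : ∀ t, (labels t).Nodup → LabelsIncrease t → root? t = some m → eoc t = m + 1 →
      (∃ u, t = node m (node (m + 1) nil nil) u) ∨ ∃ u, t = node m u (node (m + 1) nil nil) := by
    intro t htn hti ht he
    obtain ⟨u, v, rfl⟩ := eq_node_of_root? ht
    rcases minimal_child_cases u v with ⟨rfl, rfl⟩ | ⟨b, hb, h⟩ | ⟨b, hb, h⟩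
    · simp [eoc] at he
    · rw [eoc_of_lt hb h] at he
      have h6 := hti.1 b hb
      have h7 := hti.2.2.1.root_le_eoc hb
      obtain rfl : b = m + 1 := by omega
      exact .inl ⟨v, by rw [hti.2.2.1.eq_leaf_of_eoc hb he]⟩
    · rw [eoc_of_le hb h] at he
      have h6 := hti.2.1 b hb
      have h7 := hti.2.2.2.root_le_eoc hb
      obtain rfl : b = m + 1 := by omega
      exact .inr ⟨u, by rw [hti.2.2.2.eq_leaf_of_eoc hb he]⟩
  have aux' : ∀ t, (labels t).Nodup → LabelsIncrease t → (∃ u, t = node m (node (m + 1) nil nil) u) ∨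
      (∃ u, t = node m u (node (m + 1) nil nil)) → root? t = some m ∧ eoc t = m + 1 := by
    rintro t htn hti (⟨u, rfl⟩ | ⟨u, rfl⟩)
    · refine ⟨rfl, eoc_of_lt rfl fun b hb => ?_⟩
      have h6 := hti.2.1 b hb
      have h7 : b ≠ m + 1 := by
        rintro rfl
        simp [labels, mem_labels_of_root? hb] at htn
      omega
    · refine ⟨rfl, eoc_of_le rfl fun b hb => ?_⟩
      have h6 := hti.1 b hb
      omega
  constructor
  · rintro ⟨h6, h7⟩
    have hx : ¬ IsChild x (m + 1) (fill c (node x l r)) := fun h =>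
      h3.ne (h.parent_unique hn h1.2.1 h7)
    rw [isChild_fill_node_iff hn, not_or] at hx
    rcases minimal_child_cases l r with ⟨rfl, rfl⟩ | ⟨b, hb, h⟩ | ⟨b, hb, h⟩
    · have : x = m + 1 := h6
      omega
    · rw [eoc_of_lt hb h] at h6
      have h8 := h4 b hb
      have h9 := hi.2.2.1.root_le_eoc hb
      have h10 : b ≠ m + 1 := fun h => hx.1 (h ▸ hb)
      obtain rfl : b = m := by omega
      exact .inr (.inr (aux l hn'.2.1 hi.2.2.1 hb h6))
    · rw [eoc_of_le hb h] at h6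
      have h8 := h5 b hb
      have h9 := hi.2.2.2.root_le_eoc hb
      have h10 : b ≠ m + 1 := fun h => hx.2 (h ▸ hb)
      obtain rfl : b = m := by omega
      rcases aux r hn'.2.2.1 hi.2.2.2 hb h6 with h | h
      exacts [.inl h, .inr (.inl h)]
  · rw [← or_assoc]
    rintro (h6 | h6)
    · obtain ⟨h7, h8⟩ := aux' r hn'.2.2.1 hi.2.2.2 h6
      refine ⟨(eoc_of_le h7 fun b hb => h4 b hb).trans h8, ?_⟩
      rcases h6 with ⟨u, rfl⟩ | ⟨u, rfl⟩
      · exact (isChild_fill_right_iff hn).2 (.inl rfl)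
      · exact (isChild_fill_right_iff hn).2 (.inr rfl)
    · obtain ⟨h7, h8⟩ := aux' l hn'.2.1 hi.2.2.1 h6
      refine ⟨(eoc_of_lt h7 fun b hb => lt_of_le_of_ne (h5 b hb) ?_).trans h8, ?_⟩
      · rintro rfl
        exact hlr _ (mem_labels_of_root? h7) (mem_labels_of_root? hb)
      rcases h6 with ⟨u, rfl⟩ | ⟨u, rfl⟩
      · exact (isChild_fill_left_iff hn).2 (.inl rfl)
      · exact (isChild_fill_left_iff hn).2 (.inr rfl)

/-- The chain node after the cut can only be `m`, which is then a leaf; a sibling of `m` is the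
other child of the cut node. -/
theorem isPushed_iff_of_mem_chainCuts (hS : S.Nodup) (hmk : m ≤ k) {q : Cut}
    (hq : q ∈ chainCuts m k N S) :
    eoc q.toTree = m ∧ (∃ p, IsChild p m q.toTree ∧ IsChild p (m + 1) q.toTree) ↔
      q.IsPushed (m + 1) m := by
  obtain ⟨c, x, l, r⟩ := q
  obtain ⟨h1, -, h2, h3, h4, h5⟩ := (mem_chainCuts_iff hmk).1 hq
  dsimp only at h2 h3 h4 h5
  have hn : (labels (fill c (node x l r))).Nodup := h1.1 ▸ hS
  have hi : LabelsIncrease (node x l r) := h1.2.1.of_fill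
  simp only [Cut.toTree, Cut.IsPushed, eoc_fill (s := node x l r) rfl h2]
  constructor
  · rintro ⟨h6, p, h7, h8⟩
    rcases minimal_child_cases l r with ⟨rfl, rfl⟩ | ⟨b, hb, h⟩ | ⟨b, hb, h⟩
    · have : x = m := h6
      omega
    · rw [eoc_of_lt hb h] at h6
      have h9 := h4 b hb
      have h10 := hi.2.2.1.root_le_eoc hb
      obtain rfl : b = m := by omega
      obtain rfl := h7.parent_unique hn h1.2.1 ((isChild_fill_node_iff hn).2 (.inl hb))
      rw [isChild_fill_node_iff hn] at h8
      rcases h8 with h8 | h8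
      · rw [hb, Option.some.injEq] at h8
        omega
      · obtain ⟨u, v, rfl⟩ := eq_node_of_root? h8
        exact .inl ⟨u, v, hi.2.2.1.eq_leaf_of_eoc hb h6, rfl⟩
    · rw [eoc_of_le hb h] at h6
      have h9 := h5 b hb
      have h10 := hi.2.2.2.root_le_eoc hb
      obtain rfl : b = m := by omega
      obtain rfl := h7.parent_unique hn h1.2.1 ((isChild_fill_node_iff hn).2 (.inr hb))
      rw [isChild_fill_node_iff hn] at h8
      rcases h8 with h8 | h8
      · obtain ⟨u, v, rfl⟩ := eq_node_of_root? h8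
        exact .inr ⟨u, v, rfl, hi.2.2.2.eq_leaf_of_eoc hb h6⟩
      · rw [hb, Option.some.injEq] at h8
        omega
  · rintro (⟨u, v, rfl, rfl⟩ | ⟨u, v, rfl, rfl⟩)
    · exact ⟨eoc_of_lt rfl (by simp [root?]), x, (isChild_fill_node_iff hn).2 (.inl rfl),
        (isChild_fill_node_iff hn).2 (.inr rfl)⟩
    · exact ⟨eoc_of_le rfl (by simp [root?]), x, (isChild_fill_node_iff hn).2 (.inr rfl),
        (isChild_fill_node_iff hn).2 (.inl rfl)⟩

/-- A chain that continues past the cut only meets labels at least `m`, so `eoc < m` means that it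
stops there. -/
theorem left_eq_nil_iff_of_mem_chainCuts (hmk : m ≤ k) {q : Cut}
    (hq : q ∈ chainCuts m k N S) : eoc q.toTree < m ↔ q.l = nil := by
  obtain ⟨c, x, l, r⟩ := q
  obtain ⟨h1, -, h2, h3, h4, h5⟩ := (mem_chainCuts_iff hmk).1 hq
  dsimp only at h2 h3 h4 h5
  have hi : LabelsIncrease (node x l r) := h1.2.1.of_fill
  have ho : OddLeft (node x l r) := h1.2.2.of_fill
  simp only [Cut.toTree, eoc_fill (s := node x l r) rfl h2]
  constructor
  · intro h6
    rcases minimal_child_cases l r with ⟨rfl, rfl⟩ | ⟨b, hb, h⟩ | ⟨b, hb, h⟩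
    · rfl
    · rw [eoc_of_lt hb h] at h6
      have h9 := h4 b hb
      have h10 := hi.2.2.1.root_le_eoc hb
      omega
    · rw [eoc_of_le hb h] at h6
      have h9 := h5 b hb
      have h10 := hi.2.2.2.root_le_eoc hb
      omega
  · rintro rfl
    obtain h | ⟨-, rfl⟩ := ho.1
    · simp at h
    · exact h3

end chainCuts

/-! ### Exchanging `m` and `m + 1` at the end of the minimal chain -/

theorem not_isChild_of_eoc {t : BinaryTree ℕ} (hn : (labels t).Nodup) (hi : LabelsIncrease t)
    (b : ℕ) : ¬ IsChild (eoc t) b t := by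
  induction t with
  | nil => exact id
  | node a l r hl hr =>
    obtain ⟨h1, h2, h3, h4⟩ := hi
    simp only [labels, Multiset.nodup_cons, Multiset.nodup_add, Multiset.mem_add] at hn
    rcases minimal_child_cases l r with ⟨rfl, rfl⟩ | ⟨b, hb, h⟩ | ⟨b, hb, h⟩
    · simp [IsChild, root?]
    · have hm : eoc l ∈ labels l := eoc_mem (by rintro rfl; simp [root?] at hb)
      rw [eoc_of_lt hb h]
      rintro (⟨h5, -⟩ | h5 | h5)
      · exact hn.1 (.inl (h5 ▸ hm))
      · exact hl hn.2.1 h3 h5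
      · exact Multiset.disjoint_left.1 hn.2.2.2 hm h5.mem.1
    · have hm : eoc r ∈ labels r := eoc_mem (by rintro rfl; simp [root?] at hb)
      rw [eoc_of_le hb h]
      rintro (⟨h5, -⟩ | h5 | h5)
      · exact hn.1 (.inr (h5 ▸ hm))
      · exact Multiset.disjoint_left.1 hn.2.2.2 h5.mem.1 hm
      · exact hr hn.2.2.1 h4 h5

/-- The exchange reverses only the comparison of `m` with `m + 1`. Without siblings bearing these
labels, the chain makes the same turns. -/
theorem eoc_swap_of_eq {m : ℕ} {t : BinaryTree ℕ} (hi : LabelsIncrease t) (ht : eoc t = m)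
    (h : ∀ p, ¬ (IsChild p m t ∧ IsChild p (m + 1) t)) (h0 : t ≠ nil) :
    eoc (t.map (Equiv.swap m (m + 1))) = m + 1 := by
  induction t with
  | nil => exact absurd rfl h0
  | node a l r hl hr =>
    obtain ⟨-, -, h3, h4⟩ := hi
    have hcmp : ∀ b c, b ≤ m → b ≤ c → ¬ (b = m ∧ c = m + 1) →
        Equiv.swap m (m + 1) b ≤ Equiv.swap m (m + 1) c ∧
        (b < c → Equiv.swap m (m + 1) b < Equiv.swap m (m + 1) c) := by
      intro b c h1 h2 h3
      simp only [Equiv.swap_apply_def]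
      split_ifs <;> omega
    rcases minimal_child_cases l r with ⟨rfl, rfl⟩ | ⟨b, hb, h'⟩ | ⟨b, hb, h'⟩
    · have : a = m := ht
      simp [BinaryTree.map, eoc, this]
    · rw [eoc_of_lt hb h'] at ht
      have hbm := h3.root_le_eoc hb
      rw [BinaryTree.map, eoc_of_lt (b := Equiv.swap m (m + 1) b) _ _, hl h3 ht]
      · exact fun p hp => h p ⟨.inr (.inl hp.1), .inr (.inl hp.2)⟩
      · rintro rfl
        simp [root?] at hb
      · rw [root?_map, hb, Option.map_some]
      · intro c hc
        rw [root?_map, Option.map_eq_some_iff] at hc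
        obtain ⟨c, hc, rfl⟩ := hc
        refine (hcmp b c (ht ▸ hbm) (h' c hc).le ?_).2 (h' c hc)
        rintro ⟨rfl, rfl⟩
        exact h a ⟨.inl ⟨rfl, .inl hb⟩, .inl ⟨rfl, .inr hc⟩⟩
    · rw [eoc_of_le hb h'] at ht
      have hbm := h4.root_le_eoc hb
      rw [BinaryTree.map, eoc_of_le (c := Equiv.swap m (m + 1) b) _ _, hr h4 ht]
      · exact fun p hp => h p ⟨.inr (.inr hp.1), .inr (.inr hp.2)⟩
      · rintro rfl
        simp [root?] at hb
      · rw [root?_map, hb, Option.map_some]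
      · intro c hc
        rw [root?_map, Option.map_eq_some_iff] at hc
        obtain ⟨c, hc, rfl⟩ := hc
        refine (hcmp b c (ht ▸ hbm) (h' c hc) ?_).1
        rintro ⟨rfl, rfl⟩
        exact h a ⟨.inl ⟨rfl, .inr hb⟩, .inl ⟨rfl, .inl hc⟩⟩

theorem isChild_of_eoc_eq_succ {t : BinaryTree ℕ} {m : ℕ} (hi : LabelsIncrease t)
    (ht : root? t = some m) (he : eoc t = m + 1) : IsChild m (m + 1) t := by
  obtain ⟨u, v, rfl⟩ := eq_node_of_root? ht
  rcases minimal_child_cases u v with ⟨rfl, rfl⟩ | ⟨b, hb, h⟩ | ⟨b, hb, h⟩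
  · simp [eoc] at he
  · rw [eoc_of_lt hb h] at he
    have h6 := hi.1 b hb
    have h7 := hi.2.2.1.root_le_eoc hb
    obtain rfl : b = m + 1 := by omega
    exact .inl ⟨rfl, .inl hb⟩
  · rw [eoc_of_le hb h] at he
    have h6 := hi.2.1 b hb
    have h7 := hi.2.2.2.root_le_eoc hb
    obtain rfl : b = m + 1 := by omega
    exact .inl ⟨rfl, .inr hb⟩

/-- If `m` were on the chain, the next label would be `m + 1`, a child of `m`. Hence `m` is off the
chain and no turn changes. -/
theorem eoc_swap_of_eq_succ {m : ℕ} {t : BinaryTree ℕ} (hi : LabelsIncrease t)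
    (ht : eoc t = m + 1) (h : ¬ IsChild m (m + 1) t) :
    eoc (t.map (Equiv.swap m (m + 1))) = m := by
  induction t with
  | nil => simp [eoc] at ht
  | node a l r hl hr =>
    obtain ⟨-, -, h3, h4⟩ := hi
    have hcmp : ∀ b c, b ≤ m + 1 → b ≠ m → b ≤ c →
        Equiv.swap m (m + 1) b ≤ Equiv.swap m (m + 1) c ∧
        (b < c → Equiv.swap m (m + 1) b < Equiv.swap m (m + 1) c) := by
      intro b c h1 h2 h3
      simp only [Equiv.swap_apply_def]
      split_ifs <;> omega
    rcases minimal_child_cases l r with ⟨rfl, rfl⟩ | ⟨b, hb, h'⟩ | ⟨b, hb, h'⟩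
    · have : a = m + 1 := ht
      simp [BinaryTree.map, eoc, this]
    · rw [eoc_of_lt hb h'] at ht
      have hbm := h3.root_le_eoc hb
      rw [BinaryTree.map, eoc_of_lt (b := Equiv.swap m (m + 1) b) _ _, hl h3 ht]
      · exact fun h5 => h (.inr (.inl h5))
      · rw [root?_map, hb, Option.map_some]
      · intro c hc
        rw [root?_map, Option.map_eq_some_iff] at hc
        obtain ⟨c, hc, rfl⟩ := hc
        refine (hcmp b c (ht ▸ hbm) ?_ (h' c hc).le).2 (h' c hc)
        rintro rfl
        exact h (.inr (.inl (isChild_of_eoc_eq_succ h3 hb ht)))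
    · rw [eoc_of_le hb h'] at ht
      have hbm := h4.root_le_eoc hb
      rw [BinaryTree.map, eoc_of_le (c := Equiv.swap m (m + 1) b) _ _, hr h4 ht]
      · exact fun h5 => h (.inr (.inr h5))
      · rw [root?_map, hb, Option.map_some]
      · intro c hc
        rw [root?_map, Option.map_eq_some_iff] at hc
        obtain ⟨c, hc, rfl⟩ := hc
        refine (hcmp b c (ht ▸ hbm) ?_ (h' c hc)).1
        rintro rfl
        exact h (.inr (.inr (isChild_of_eoc_eq_succ h4 hb ht)))

/-- The end of the minimal chain is the smallest child of its parent. -/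
theorem not_siblings_of_eoc_eq_succ {m : ℕ} {t : BinaryTree ℕ} (hn : (labels t).Nodup)
    (hi : LabelsIncrease t) (ht : eoc t = m + 1) (p : ℕ) :
    ¬ (IsChild p m t ∧ IsChild p (m + 1) t) := by
  rintro ⟨h1, h2⟩
  obtain ⟨b, hb⟩ : ∃ b, root? t = some b := by
    cases t with
    | nil => exact h1.elim
    | node b l r => exact ⟨b, rfl⟩
  obtain ⟨c, q, l, r, rfl, h3, h4, h5, h6⟩ :=
    exists_fill_onChain hb (Nat.lt_succ_of_le (hi.root_le hb h1.mem.2))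
  rw [eoc_fill (s := node q l r) rfl h3] at ht
  have hi' : LabelsIncrease (node q l r) := hi.of_fill
  have h7 : root? l = some (m + 1) ∨ root? r = some (m + 1) := by
    rcases minimal_child_cases l r with ⟨rfl, rfl⟩ | ⟨b, hb, h⟩ | ⟨b, hb, h⟩
    · have : q = m + 1 := ht
      omega
    · rw [eoc_of_lt hb h] at ht
      have h8 := h5 b hb
      have h9 := hi'.2.2.1.root_le_eoc hb
      exact .inl (by rw [hb, Option.some.injEq]; omega)
    · rw [eoc_of_le hb h] at ht
      have h8 := h6 b hb
      have h9 := hi'.2.2.2.root_le_eoc hb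
      exact .inr (by rw [hb, Option.some.injEq]; omega)
  obtain rfl := h2.parent_unique hn hi ((isChild_fill_node_iff hn).2 h7)
  rcases (isChild_fill_node_iff hn).1 h1 with h | h
  · have := h5 m h
    omega
  · have := h6 m h
    omega

theorem ncard_swap_eoc {m k N : ℕ} (hm : 1 ≤ m) (hmk : m + 1 < k) (hkN : k < N) :
    {t | Good (Finset.Icc 1 N).val t ∧ (IsChild k N t ∧
      eoc t = m ∧ ¬ ∃ p, IsChild p m t ∧ IsChild p (m + 1) t)}.ncard =
    {t | Good (Finset.Icc 1 N).val t ∧ (IsChild k N t ∧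
      eoc t = m + 1 ∧ ¬ IsChild m (m + 1) t)}.ncard := by
  have hN : Equiv.swap m (m + 1) N = N := Equiv.swap_apply_of_ne_of_ne (by omega) (by omega)
  have hk : Equiv.swap m (m + 1) k = k := Equiv.swap_apply_of_ne_of_ne (by omega) (by omega)
  refine ncard_eq_of_relabel (Equiv.swap m (m + 1))
    (fun a => swap_mem_Icc_iff (by omega) (by omega)) ?_ ?_
  · rintro t ht hi ⟨h1, h2, h3⟩
    have hn : (labels t).Nodup := by
      rw [ht]
      exact Finset.nodup _
    have h4 : ¬ IsChild m (m + 1) t := by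
      have := not_isChild_of_eoc hn hi (m + 1)
      rwa [h2] at this
    refine ⟨labelsIncrease_swap hi h4, ?_, ?_, not_isChild_swap hi⟩
    · rwa [isChild_map_iff, Equiv.symm_swap, hN, hk]
    · refine eoc_swap_of_eq hi h2 (fun p hp => h3 ⟨p, hp⟩) ?_
      rintro rfl
      exact h1
  · rintro t ht hi ⟨h1, h2, h3⟩
    have hn : (labels t).Nodup := by
      rw [ht]
      exact Finset.nodup _
    rw [Equiv.symm_swap]
    refine ⟨labelsIncrease_swap hi h3, ?_, eoc_swap_of_eq_succ hi h2 h3, ?_⟩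
    · rwa [isChild_map_iff, Equiv.symm_swap, hN, hk]
    · rintro ⟨p, h4, h5⟩
      rw [isChild_map_iff, Equiv.symm_swap, Equiv.swap_apply_left] at h4
      rw [isChild_map_iff, Equiv.symm_swap, Equiv.swap_apply_right] at h5
      exact not_siblings_of_eoc_eq_succ hn hi h2 _ ⟨h5, h4⟩

/-- Relabeling after the removal of `m` and `m + 1`. -/
theorem ncard_remove_pair {m k N : ℕ} (hm : 1 ≤ m) (hmk : m + 1 < k) (hkN : k < N) (p : Prop) :
    {t | Good (Finset.Icc 1 N \ {m, m + 1}).val t ∧ (IsChild k N t ∧ (p → eoc t < m))}.ncard =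
    {t | Good (Finset.Icc 1 (N - 2)).val t ∧
      (IsChild (k - 2) (N - 2) t ∧ (p → eoc t < m))}.ncard := by
  have hmN : m ≤ N := by omega
  -- Applying the cycle twice lowers by two the labels from `m + 2` to `N`.
  set σ : Equiv.Perm ℕ := (moveUp m N hmN).trans (moveUp m N hmN) with hσ
  have h1 : ∀ b, b < m → σ b = b := fun b hb => by
    simp only [hσ, Equiv.trans_apply, moveUp_apply]
    split_ifs
    omega
  have h2 : ∀ b, m + 1 < b → b ≤ N → σ b = b - 2 := fun b hb hb' => by
    simp only [hσ, Equiv.trans_apply, moveUp_apply]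
    split_ifs <;> omega
  have h3 : ∀ b, b < m → σ.symm b = b := fun b hb => by rw [Equiv.symm_apply_eq, h1 b hb]
  have h4 : ∀ b, m ≤ b → b ≤ N - 2 → σ.symm b = b + 2 := fun b hb hb' => by
    rw [Equiv.symm_apply_eq, h2 (b + 2) (by omega) (by omega), Nat.add_sub_cancel]
  -- The deleted labels go to `N - 1` and `N`, outside the target interval, as an equivalence over
  -- all naturals requires.
  have hσm : ∀ b, σ m = b → b = N - 1 := fun b hb => by
    simp only [hσ, Equiv.trans_apply, moveUp_apply] at hb
    split_ifs at hb <;> omega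
  have hσm' : ∀ b, σ (m + 1) = b → b = N := fun b hb => by
    simp only [hσ, Equiv.trans_apply, moveUp_apply] at hb
    split_ifs at hb <;> omega
  have hσN : ∀ b, N < b → σ b = b := fun b hb => by
    simp only [hσ, Equiv.trans_apply, moveUp_apply]
    split_ifs <;> omega
  have hmono : ∀ a ∈ Finset.Icc 1 N \ {m, m + 1}, ∀ b ∈ Finset.Icc 1 N \ {m, m + 1}, a < b →
      σ a < σ b := by
    intro a ha b hb hab
    simp only [Finset.mem_sdiff, Finset.mem_Icc, Finset.mem_insert, Finset.mem_singleton] at ha hb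
    rcases lt_or_ge a m with h | h <;> rcases lt_or_ge b m with h' | h'
    · rwa [h1 a h, h1 b h']
    · rw [h1 a h, h2 b (by omega) (by omega)]
      omega
    · omega
    · rw [h2 a (by omega) (by omega), h2 b (by omega) (by omega)]
      omega
  have hmono' : ∀ a ∈ Finset.Icc 1 (N - 2), ∀ b ∈ Finset.Icc 1 (N - 2), a < b →
      σ.symm a < σ.symm b := by
    intro a ha b hb hab
    simp only [Finset.mem_Icc] at ha hb
    rcases lt_or_ge a m with h | h <;> rcases lt_or_ge b m with h' | h'
    · rwa [h3 a h, h3 b h']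
    · rw [h3 a h, h4 b (by omega) (by omega)]
      omega
    · omega
    · rw [h4 a (by omega) (by omega), h4 b (by omega) (by omega)]
      omega
  have hne : ∀ {t a b}, IsChild a b t → t ≠ nil := by
    rintro _ a b h rfl
    exact h
  refine ncard_eq_of_relabel σ (fun a => ?_) ?_ ?_
  · simp only [Finset.mem_sdiff, Finset.mem_Icc, Finset.mem_insert, Finset.mem_singleton]
    rcases lt_or_ge a m with h | h
    · rw [h1 a h]
      omega
    · rcases eq_or_ne a m with rfl | h'
      · have := hσm _ rfl
        omega
      rcases eq_or_ne a (m + 1) with rfl | h''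
      · have := hσm' _ rfl
        omega
      rcases le_or_gt a N with h5 | h5
      · rw [h2 a (by omega) h5]
        omega
      · rw [hσN a h5]
        omega
  · rintro t ht hi ⟨h5, h6⟩
    have hmem : ∀ a ∈ labels t, a ∈ Finset.Icc 1 N \ {m, m + 1} := fun a ha => by rwa [ht] at ha
    refine ⟨labelsIncrease_map _ fun a b hab => ?_, ?_, fun hp => ?_⟩
    · exact hmono _ (hmem _ hab.mem.1) _ (hmem _ hab.mem.2) (labelsIncrease_iff.1 hi a b hab)
    · rw [isChild_map_iff, h4 _ (by omega) (by omega), h4 _ (by omega) (by omega)]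
      rwa [Nat.sub_add_cancel (by omega), Nat.sub_add_cancel (by omega)]
    · rw [eoc_map_of_strictMonoOn (hne h5) fun a ha b hb => hmono a (hmem a ha) b (hmem b hb),
        h1 _ (h6 hp)]
      exact h6 hp
  · rintro t ht hi ⟨h5, h6⟩
    have hmem : ∀ a ∈ labels t, a ∈ Finset.Icc 1 (N - 2) := fun a ha => by rwa [ht] at ha
    refine ⟨labelsIncrease_map _ fun a b hab => ?_, ?_, fun hp => ?_⟩
    · exact hmono' _ (hmem _ hab.mem.1) _ (hmem _ hab.mem.2) (labelsIncrease_iff.1 hi a b hab)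
    · rwa [isChild_map_iff, Equiv.symm_symm, h2 _ (by omega) (by omega),
        h2 _ (by omega) (by omega)]
    · rw [eoc_map_of_strictMonoOn (hne h5) fun a ha b hb => hmono' a (hmem a ha) b (hmem b hb),
        h3 _ (h6 hp)]
      exact h6 hp

theorem f_eq_and_comm {n m k : ℕ} (hn : n ≠ 0) (hk : k ≠ 0) :
    f n m k = ({t | Good (Finset.Icc 1 n).val t ∧ IsChild k n t ∧ eoc t = m}.ncard : ℤ) := by
  simp only [f_eq hn hk, and_comm]

theorem diffM_f_eq {m k N : ℕ} (hm : 2 ≤ m) (hmk : m + 1 < k) (hkN : k < N) :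
    diffM (f N) m k =
      2 * {t | Good (Finset.Icc 1 (N - 2)).val t ∧ IsChild (k - 2) (N - 2) t}.ncard -
      4 * {t | Good (Finset.Icc 1 (N - 2)).val t ∧
        (IsChild (k - 2) (N - 2) t ∧ eoc t < m)}.ncard := by
  have hmI : m ∈ Finset.Icc 1 N := Finset.mem_Icc.2 (by omega)
  have hmI' : m + 1 ∈ Finset.Icc 1 N := Finset.mem_Icc.2 (by omega)
  have hval := val_eq_pair_add_sdiff hmI hmI' (by omega)
  have hmk' : m ≤ k := by omega
  set S := (Finset.Icc 1 N \ {m, m + 1}).val with hS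
  have hIn : (Finset.Icc 1 N).val.Nodup := Finset.nodup _
  -- Since `2 ≤ m`, the label `1` survives the deletion and lies below `m`; it forces the root below
  -- `m`, so that the chain can be cut.
  have h1S : 1 ∈ S := by
    simp only [hS, Finset.mem_val, Finset.mem_sdiff, Finset.mem_Icc, Finset.mem_insert,
      Finset.mem_singleton]
    omega
  have hyS : m ∉ S := by
    rw [hS, Finset.mem_val, Finset.mem_sdiff, Finset.mem_insert]
    tauto
  have hzS : m + 1 ∉ S := by
    rw [hS, Finset.mem_val, Finset.mem_sdiff, Finset.mem_insert, Finset.mem_singleton]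
    tauto
  have h1I : 1 ∈ (Finset.Icc 1 N).val := by
    rw [Finset.mem_val, Finset.mem_Icc]
    omega
  have e1 := ncard_and_add_ncard_and_not (P := fun t => Good (Finset.Icc 1 N).val t ∧
    (IsChild k N t ∧ eoc t = m + 1)) (Q := IsChild m (m + 1))
    ((finite_good _).subset fun _ h => h.1)
  have e2 := ncard_and_add_ncard_and_not (P := fun t => Good (Finset.Icc 1 N).val t ∧
    (IsChild k N t ∧ eoc t = m)) (Q := fun t => ∃ p, IsChild p m t ∧ IsChild p (m + 1) t)
    ((finite_good _).subset fun _ h => h.1)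
  have e3 := ncard_swap_eoc (by omega : 1 ≤ m) hmk hkN
  simp only [and_assoc] at e1 e2
  have e4 := ncard_eq_ncard_chainCuts hmk' (N := N) h1I (by omega)
    (P := fun t => eoc t = m + 1 ∧ IsChild m (m + 1) t)
    (fun q hq => isGrown_iff_of_mem_chainCuts hIn hmk' hq)
  have e5 := ncard_eq_ncard_chainCuts hmk' (N := N) h1I (by omega)
    (P := fun t => eoc t = m ∧ ∃ p, IsChild p m t ∧ IsChild p (m + 1) t)
    (fun q hq => isPushed_iff_of_mem_chainCuts hIn hmk' hq)
  have e6 := ncard_eq_ncard_chainCuts hmk' (N := N) h1S (by omega)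
    (P := fun t => False → eoc t < m) (P' := fun _ => True) (fun q hq => by simp)
  have e7 := ncard_eq_ncard_chainCuts hmk' (N := N) h1S (by omega)
    (P := fun t => True → eoc t < m) (P' := fun q => q.l = nil)
    (fun q hq => by rw [true_implies]; exact left_eq_nil_iff_of_mem_chainCuts hmk' hq)
  have hW : ∀ y, y ≠ k → Inherits (IsChild k N) y := fun y hy l r => by simp [IsChild, hy]
  -- In pushed cuts the roles are exchanged: the leaf is the smaller label `m`, which ends the
  -- chain, and `m + 1` carries the old subtrees.
  have e8 := ncard_grown_add (finite_chainCuts hmk' (N := N)) (z := m + 1) hyS hzS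
    (Nat.lt_succ_self m) (.inr ⟨rfl, rfl, rfl⟩) id (hW m (by omega)) (hW (m + 1) (by omega))
  rw [← hval] at e8
  rw [hS, ncard_remove_pair (by omega) hmk hkN] at e6 e7
  rw [← hS] at e6 e7
  simp only [false_implies, true_implies, and_true, Set.ofPred_mem_eq] at e6 e7
  rw [e6, e7, diffM, f_eq_and_comm (by omega) (by omega), f_eq_and_comm (by omega) (by omega),
    ← e1, ← e2, e3, e4, e5]
  push_cast
  unfold chainCuts
  linear_combination e8

/-- In `diffM_f_eq` only the count of `eoc < m` depends on `m`, and its increment is the count of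
`eoc = m`. -/
theorem diffM_diffM_f {m k N : ℕ} (hm : 2 ≤ m) (hmk : m + 3 ≤ k) (hkN : k < N) :
    diffM (diffM (f N)) m k + 4 * f (N - 2) m (k - 2) = 0 := by
  have e1 := ncard_and_add_ncard_and_not (P := fun t => Good (Finset.Icc 1 (N - 2)).val t ∧
    (IsChild (k - 2) (N - 2) t ∧ eoc t < m + 1)) (Q := fun t => eoc t = m)
    ((finite_good _).subset fun _ h => h.1)
  have h1 : ∀ e : ℕ, e < m + 1 ∧ e = m ↔ e = m := by omega
  have h2 : ∀ e : ℕ, e < m + 1 ∧ ¬ e = m ↔ e < m := by omega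
  simp only [and_assoc, h1, h2] at e1
  rw [diffM, diffM_f_eq (by omega) (by omega) hkN, diffM_f_eq hm (by omega) hkN, ← e1,
    f_eq_and_comm (by omega) (by omega)]
  push_cast
  ring

end SecantTree

theorem theorem1p1 :
    (∀ n m k : ℕ, 2 ≤ m → m + 3 ≤ k → k + 1 ≤ 2 * n →
      SecantTree.diffM (SecantTree.diffM (SecantTree.f (2 * n))) m k
        + 4 * SecantTree.f (2 * n - 2) m (k - 2) = 0) ∧
    (∀ n m k : ℕ, 2 ≤ m → m + 1 ≤ k → k + 3 ≤ 2 * n →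
      SecantTree.diffK (SecantTree.diffK (SecantTree.f (2 * n))) m k
        + 4 * SecantTree.f (2 * n - 2) m k = 0) :=
  ⟨fun _ _ _ hm hmk hkn => SecantTree.diffM_diffM_f hm hmk hkn,
    fun _ _ _ _ hmk hkn => SecantTree.diffK_diffK_f hmk hkn⟩
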